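/- Let $n\ge 2$, $0<\alpha<2$, and write $\widehat f(\xi)=\int_{\mathbb R^n} f(x)e^{-i\xi\cdot x}\,dx$. For probability densities $f,g$ on $\mathbb R^n$ let $$E_\alpha(f,g)=2\iint |x-y|^\alpha f(x)g(y)\,dx\,dy-\iint |x-y|^\alpha f(x)f(y)\,dx\,dy-\iint |x-y|^\alpha g(x)g(y)\,dx\,dy,$$ $$E_{-(2-\alpha)}(f,g)=\iint \frac{[f(x)-g(x)][f(y)-g(y)]}{|x-y|^{2-\alpha}}\,dx\,dy,\qquad d_1(f,g)=\sup_{\xi\ne 0}\frac{|\widehat f(\xi)-\widehat g(\xi)|}{|\xi|}\in[0,\infty].$$ Put $$c_{n,\alpha}=\frac{\alpha 2^\alpha\Gamma(\frac{n+\alpha}2)}{2\pi^{n/2}\Gamma(\frac{2-\alpha}2)},\quad d_{n,\alpha}=\frac{2^\alpha}{2^2\pi^{n/2}}\frac{\Gamma(\frac{n-2+\alpha}2)}{\Gamma(\frac{2-\alpha}2)},\quad A_{n,\alpha}=c_{n,\alpha}\frac{2\pi^{n/2}}{\Gamma(\frac n2)},\quad B_{n,\alpha}=\frac{c_{n,\alpha}}{d_{n,\alpha}},$$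 $$D_{n,\alpha}=A_{n,\alpha}^{\frac2{4-\alpha}}B_{n,\alpha}^{\frac{2-\alpha}{4-\alpha}}\Big[\tfrac{2^{(2-\alpha)/(4-\alpha)}}{2-\alpha}+\big(\tfrac12\big)^{\frac2{4-\alpha}}\Big],\qquad C(\alpha,n,d)=2\alpha(n-2+\alpha)\big[D_{n,\alpha}\,d^{\frac4{4-\alpha}}\big]^{-\frac{4-\alpha}{2-\alpha}}.$$ A solution of the heat equation is a family $f(t)\in L^1(\mathbb R^n)$, $t\ge0$, bounded in $L^1$ on bounded time intervals, such that for every $\varphi\in C_c^\infty(\mathbb R^n)$ one has $\frac{d}{dt}\int f(t)\varphi\,dx=\int f(t)\Delta\varphi\,dx$ for $t>0$ and $\int f(t)\varphi\,dx\to\int f(0)\varphi\,dx$ as $t\to0^+$. Let $f(t),g(t)$ be solutions of the heat equation $\partial_t f=\Delta f$ on $\mathbb R^n$ whose initial data $f_0=f(0)$, $g_0=g(0)$ are probability densities with finite moments of order $\alpha$ and with $d_1(f_0,g_0)<\infty$, and let $C=C(\alpha,n,d_1(f_0,g_0))$. Then $C>0$ unless $f_0=g_0$ almost everywhere; the integrals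 defining $E_\alpha(f(t),g(t))$ converge absolutely for $t\ge 0$, as do, for $t>0$, the integrals $\iint|x-y|^{-(2-\alpha)}u(x)v(y)\,dx\,dy$ with $u,v\in\{f(t),g(t)\}$; for every $t>0$ $$\frac{d}{dt}E_\alpha(f(t),g(t))=-2\alpha(n-2+\alpha)E_{-(2-\alpha)}(f(t),g(t))\le -C\,E_\alpha(f(t),g(t))^{\frac{4-\alpha}{2-\alpha}};$$ and for every $t\ge0$ $$E_\alpha(f(t),g(t))\le\Big(E_\alpha(f_0,g_0)^{-\frac{2}{2-\alpha}}+C\,\frac{2}{2-\alpha}\,t\Big)^{-\frac{2-\alpha}2}.$$ In particular $E_\alpha(f(t),g(t))\le\big(C\frac{2}{2-\alpha}t\big)^{-\frac{2-\alpha}{2}}$ for $t>0$. (If $f_0=g_0$ almost everywhere, then $C$ and the right-hand sides are read as $0$.) The same holds for $t>0$ when $g(t)$ is the Gaussian fundamental solution $(4\pi t)^{-n/2}e^{-|x|^2/(4t)}$, with the initial quantities taken relative to the Dirac mass $\delta_0$: if $d_1(f_0,\delta_0)=\sup_{\xi\neq0}|\widehat f_0(\xi)-1|/|\xi|<\infty$,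 then all of the above is true with $C=C(\alpha,n,d_1(f_0,\delta_0))>0$ and with $E_\alpha(f_0,g_0)$ replaced by $E_\alpha(f_0,\delta_0)=2\int|x|^\alpha f_0(x)\,dx-\iint|x-y|^\alpha f_0(x)f_0(y)\,dx\,dy$. -/

import Mathlib

open MeasureTheory Filter Topology
open scoped ENNReal ContDiff

noncomputable section

namespace HeatEnergy

/-- A probability density on `ℝⁿ`. -/
def IsProbDensity {n : ℕ} (f : EuclideanSpace ℝ (Fin n) → ℝ) : Prop :=
  (∀ᵐ x, 0 ≤ f x) ∧ Integrable f ∧ ∫ x, f x = 1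

/-- The moment of order `α` of `f` is finite. -/
def HasMoment {n : ℕ} (α : ℝ) (f : EuclideanSpace ℝ (Fin n) → ℝ) : Prop :=
  Integrable (fun x => ‖x‖ ^ α * f x)

/-- Weak (distributional) solutions `f(x,t)`, `t ≥ 0`, of the heat equation `∂ₜ f = Δ f` on `ℝⁿ`
with initial datum `f(·,0)`, in the class of functions bounded in `L¹` locally in time.
Every classical solution made of probability densities which attains its initial datum in the
sense of distributions is of this kind. -/
structure IsHeatSolution {n : ℕ} (f : ℝ → EuclideanSpace ℝ (Fin n) → ℝ) : Prop where
  integrable : ∀ t, 0 ≤ t → Integrable (f t)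
  bounded : ∀ T, 0 ≤ T → ∃ M : ℝ, ∀ t, 0 ≤ t → t ≤ T → ∫ x, |f t x| ≤ M
  equation : ∀ φ : EuclideanSpace ℝ (Fin n) → ℝ, ContDiff ℝ ∞ φ → HasCompactSupport φ →
    ∀ t, 0 < t →
      HasDerivAt (fun s => ∫ x, f s x * φ x) (∫ x, f t x * Laplacian.laplacian φ x) t
  initial : ∀ φ : EuclideanSpace ℝ (Fin n) → ℝ, ContDiff ℝ ∞ φ → HasCompactSupport φ →
    Tendsto (fun t => ∫ x, f t x * φ x) (𝓝[>] 0) (𝓝 (∫ x, f 0 x * φ x))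

/-- The fundamental solution of the heat equation: the Gaussian density with zero mean and
variance `2t`. -/
def heatKernel (n : ℕ) (t : ℝ) (x : EuclideanSpace ℝ (Fin n)) : ℝ :=
  (4 * Real.pi * t) ^ (-((n : ℝ) / 2)) * Real.exp (-(‖x‖ ^ 2 / (4 * t)))

/-- The Fourier transform `∫ f(x) exp(-i ξ·x) dx`. -/
def fourierHat {n : ℕ} (f : EuclideanSpace ℝ (Fin n) → ℝ) (ξ : EuclideanSpace ℝ (Fin n)) : ℂ :=
  ∫ x, Complex.exp (-Complex.I * ((inner ℝ ξ x : ℝ) : ℂ)) * ((f x : ℝ) : ℂ)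

/-- The Fourier-based distance `d₁(f,g) = sup_{ξ ≠ 0} |f̂(ξ) - ĝ(ξ)| / |ξ|`, in `[0,∞]`. -/
def fourierDist {n : ℕ} (f g : EuclideanSpace ℝ (Fin n) → ℝ) : ℝ≥0∞ :=
  ⨆ (ξ : EuclideanSpace ℝ (Fin n)) (_ : ξ ≠ 0),
    ENNReal.ofReal (‖fourierHat f ξ - fourierHat g ξ‖ / ‖ξ‖)

/-- The Fourier-based distance `d₁(f,δ₀)` to the Dirac mass at the origin, whose Fourier
transform is `1`. -/
def fourierDistDirac {n : ℕ} (f : EuclideanSpace ℝ (Fin n) → ℝ) : ℝ≥0∞ :=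
  ⨆ (ξ : EuclideanSpace ℝ (Fin n)) (_ : ξ ≠ 0),
    ENNReal.ofReal (‖fourierHat f ξ - 1‖ / ‖ξ‖)

/-- The integral `∬ |x-y|^s f(x) g(y) dx dy`. -/
def interaction {n : ℕ} (s : ℝ) (f g : EuclideanSpace ℝ (Fin n) → ℝ) : ℝ :=
  ∫ p : EuclideanSpace ℝ (Fin n) × EuclideanSpace ℝ (Fin n), ‖p.1 - p.2‖ ^ s * (f p.1 * g p.2)

/-- Absolute convergence of the integral `∬ |x-y|^s f(x) g(y) dx dy`. -/
def InteractionConverges {n : ℕ} (s : ℝ) (f g : EuclideanSpace ℝ (Fin n) → ℝ) : Prop :=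
  Integrable (fun p : EuclideanSpace ℝ (Fin n) × EuclideanSpace ℝ (Fin n) =>
    ‖p.1 - p.2‖ ^ s * (f p.1 * g p.2))

/-- All three integrals in `E_s(f,g)` converge absolutely. -/
def EnergyConverges {n : ℕ} (s : ℝ) (f g : EuclideanSpace ℝ (Fin n) → ℝ) : Prop :=
  InteractionConverges s f g ∧ InteractionConverges s f f ∧ InteractionConverges s g g

/-- The energy distance `E_α(f,g)` of order `α`, `0 < α < 2`. -/
def energyDist {n : ℕ} (α : ℝ) (f g : EuclideanSpace ℝ (Fin n) → ℝ) : ℝ :=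
  2 * interaction α f g - interaction α f f - interaction α g g

/-- The energy distance `E_α(f,δ₀)` to the Dirac mass at the origin. -/
def energyDistDirac {n : ℕ} (α : ℝ) (f : EuclideanSpace ℝ (Fin n) → ℝ) : ℝ :=
  2 * (∫ x, ‖x‖ ^ α * f x) - interaction α f f

/-- The energy distance of negative order
`E_{-(2-α)}(f,g) = ∬ |x-y|^{-(2-α)} [f(x)-g(x)] [f(y)-g(y)] dx dy`. -/
def negEnergyDist {n : ℕ} (α : ℝ) (f g : EuclideanSpace ℝ (Fin n) → ℝ) : ℝ :=
  interaction (-(2 - α)) (fun x => f x - g x) (fun x => f x - g x)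

/-- `c_{n,α}`, the constant in `E_α(f,g) = c_{n,α} ∫ |f̂ - ĝ|² / |ξ|^{n+α} dξ`. -/
def cConst (n : ℕ) (α : ℝ) : ℝ :=
  α * 2 ^ α * Real.Gamma ((n + α) / 2) /
    (2 * Real.pi ^ ((n : ℝ) / 2) * Real.Gamma ((2 - α) / 2))

/-- `d_{n,α}`, the constant in `E_{-(2-α)}(f,g) = d_{n,α} ∫ |f̂ - ĝ|² / |ξ|^{n-2+α} dξ`. -/
def dConst (n : ℕ) (α : ℝ) : ℝ :=
  2 ^ α / (2 ^ 2 * Real.pi ^ ((n : ℝ) / 2)) *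
    (Real.Gamma ((n - 2 + α) / 2) / Real.Gamma ((2 - α) / 2))

def AConst (n : ℕ) (α : ℝ) : ℝ :=
  cConst n α * (2 * Real.pi ^ ((n : ℝ) / 2) / Real.Gamma ((n : ℝ) / 2))

def BConst (n : ℕ) (α : ℝ) : ℝ := cConst n α / dConst n α

/-- `D_{n,α}`, the constant in
`E_α(f,g) ≤ D_{n,α} d₁(f,g)^{4/(4-α)} E_{-(2-α)}(f,g)^{(2-α)/(4-α)}`. -/
def DConst (n : ℕ) (α : ℝ) : ℝ :=
  AConst n α ^ (2 / (4 - α)) * BConst n α ^ ((2 - α) / (4 - α)) *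
    (2 ^ ((2 - α) / (4 - α)) / (2 - α) + (1 / 2) ^ (2 / (4 - α)))

/-- `C(α,n,d) = 2α(n-2+α) [D_{n,α} d^{4/(4-α)}]^{-(4-α)/(2-α)}`, positive for `d > 0`. -/
def decayConst (n : ℕ) (α d : ℝ) : ℝ :=
  2 * α * (n - 2 + α) * (DConst n α * d ^ (4 / (4 - α))) ^ (-((4 - α) / (2 - α)))

end HeatEnergy

end

/-!
Everything is read off in Fourier variables. Testing a weak solution against truncated plane waves
shows that its Fourier transform is `exp (-t|ξ|²)` times the initial one
(`IsHeatSolution.fourierHat_eq`); the truncation error vanishes because the solution is bounded in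
`L¹` locally in time. By injectivity of the Fourier transform, `f t` is the density of the
convolution of its initial law with the heat kernel, in particular a probability density
(`IsHeatSolution.isProbDensity_and_eq_conv`). From there on the argument concerns probability
measures, so that the Dirac mass is a legitimate initial datum and the two halves of the theorem are
instances of one statement, `measureEnergy_heat_decay`.

Both energies are mixtures over `τ` of the Gaussian energies `∬ exp (-τ|x-y|²) d(μ-ν) d(μ-ν)`, with
weights `τ^{-α/2-1}` and `τ^{-α/2}`, and the Gaussian energy is an explicit integral of
`|μ̂ - ν̂|²`. Integrating in `τ` gives
`E_α = c ∫ |μ̂ - ν̂|² |ξ|^{-(n+α)}` and `E_{-(2-α)} = d ∫ |μ̂ - ν̂|² |ξ|^{-(n-2+α)}`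
(`measureEnergy_eq_fourier`, `measureNegEnergy_eq_fourier`), with `c = α(n-2+α) d`. Along the heat
flow `|μ̂ - ν̂|²` is multiplied by `exp (-2t|ξ|²)`, so differentiation under the integral gives
the dissipation identity (`hasDerivAt_integral_heat`).

The bound `|μ̂ - ν̂| ≤ d₁|ξ|` persists under the flow. Splitting the integral for `E_α` at the
optimal radius interpolates `E_α` between `d₁` and `E_{-(2-α)}`, with exactly the constant
`DConst` (`decayConst_mul_rpow_le`). The resulting inequality `E' ≤ -C E^{1+q}`, `q = 2/(2-α)`, is
integrated in `le_of_hasDerivAt_le_neg_rpow`.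
-/

noncomputable section

namespace HeatEnergy

/-! ### The Laplacian of a truncated plane wave -/

/-- The Laplacian of a product of twice differentiable functions. -/
theorem laplacian_mul {E : Type*} [NormedAddCommGroup E] [InnerProductSpace ℝ E]
    [FiniteDimensional ℝ E] {u v : E → ℝ} (hu : ContDiff ℝ 2 u) (hv : ContDiff ℝ 2 v) (x : E) :
    Laplacian.laplacian (fun y => u y * v y) x =
      u x * Laplacian.laplacian v x + v x * Laplacian.laplacian u x +
        2 * ∑ i, fderiv ℝ u x (stdOrthonormalBasis ℝ E i) *
          fderiv ℝ v x (stdOrthonormalBasis ℝ E i) := by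
  have hu1 : Differentiable ℝ u := hu.differentiable (by norm_num)
  have hv1 : Differentiable ℝ v := hv.differentiable (by norm_num)
  have hu2 : Differentiable ℝ (fderiv ℝ u) :=
    (hu.fderiv_right (m := 1) (by norm_num)).differentiable (by norm_num)
  have hv2 : Differentiable ℝ (fderiv ℝ v) :=
    (hv.fderiv_right (m := 1) (by norm_num)).differentiable (by norm_num)
  have key : fderiv ℝ (fun y => u y * v y) = u • fderiv ℝ v + v • fderiv ℝ u := by
    funext y
    exact fderiv_fun_mul (hu1 y) (hv1 y)
  simp only [InnerProductSpace.laplacian_eq_iteratedFDeriv_stdOrthonormalBasis,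
    iteratedFDeriv_two_apply, Matrix.cons_val_zero, Matrix.cons_val_one, key]
  rw [(((hu1 x).hasFDerivAt.smul (hv2 x).hasFDerivAt).add
    ((hv1 x).hasFDerivAt.smul (hu2 x).hasFDerivAt)).fderiv]
  simp only [Finset.mul_sum, ← Finset.sum_add_distrib]
  refine Finset.sum_congr rfl fun i _ => ?_
  simp
  ring

/-- The Laplacian of a plane wave. -/
theorem laplacian_cos_inner {E : Type*} [NormedAddCommGroup E] [InnerProductSpace ℝ E]
    [FiniteDimensional ℝ E] (ξ : E) (θ : ℝ) (x : E) :
    Laplacian.laplacian (fun y => Real.cos (inner ℝ ξ y - θ)) x =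
      -‖ξ‖ ^ 2 * Real.cos (inner ℝ ξ x - θ) := by
  have hin : ∀ y : E, HasFDerivAt (fun y => inner ℝ ξ y - θ) (innerSL ℝ ξ) y := fun y =>
    (innerSL ℝ ξ).hasFDerivAt.sub_const θ
  have h1 : fderiv ℝ (fun y : E => Real.cos (inner ℝ ξ y - θ)) =
      fun y => (-Real.sin (inner ℝ ξ y - θ)) • innerSL ℝ ξ := by
    funext y
    exact (hin y).cos.fderiv
  have h2 : fderiv ℝ (fun y : E => (-Real.sin (inner ℝ ξ y - θ)) • innerSL ℝ ξ) x =
      (-(Real.cos (inner ℝ ξ x - θ) • innerSL ℝ ξ)).smulRight (innerSL ℝ ξ) :=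
    ((hin x).sin.neg.smul_const (innerSL ℝ ξ)).fderiv
  simp only [InnerProductSpace.laplacian_eq_iteratedFDeriv_stdOrthonormalBasis,
    iteratedFDeriv_two_apply, Matrix.cons_val_zero, Matrix.cons_val_one, h1, h2]
  rw [← (stdOrthonormalBasis ℝ E).sum_sq_norm_inner_left ξ, neg_mul, Finset.sum_mul,
    ← Finset.sum_neg_distrib]
  refine Finset.sum_congr rfl fun i _ => ?_
  simp
  ring

theorem fderiv_scale {E : Type*} [NormedAddCommGroup E] [NormedSpace ℝ E] (η : E → ℝ) (c : ℝ) :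
    fderiv ℝ (fun y => η (c • y)) = fun x => c • fderiv ℝ η (c • x) := by
  funext x
  exact fderiv_comp_smul (f := η) c

theorem laplacian_scale {E : Type*} [NormedAddCommGroup E] [InnerProductSpace ℝ E]
    [FiniteDimensional ℝ E] {η : E → ℝ} (hη : ContDiff ℝ 2 η) (c : ℝ) (x : E) :
    Laplacian.laplacian (fun y => η (c • y)) x = c ^ 2 * Laplacian.laplacian η (c • x) := by
  have h2 : Differentiable ℝ (fderiv ℝ η) :=
    (hη.fderiv_right (m := 1) (by norm_num)).differentiable (by norm_num)
  have h3 : fderiv ℝ (fun x => c • fderiv ℝ η (c • x)) x =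
      c • c • fderiv ℝ (fderiv ℝ η) (c • x) := by
    have h4 : DifferentiableAt ℝ (fun x => fderiv ℝ η (c • x)) x :=
      (h2 _).comp x (differentiableAt_id.const_smul c)
    rw [← fderiv_comp_smul (f := fderiv ℝ η) c]
    exact (h4.hasFDerivAt.const_smul c).fderiv
  simp only [InnerProductSpace.laplacian_eq_iteratedFDeriv_stdOrthonormalBasis,
    iteratedFDeriv_two_apply, Matrix.cons_val_zero, Matrix.cons_val_one, fderiv_scale, h3,
    Finset.mul_sum]
  refine Finset.sum_congr rfl fun i _ => ?_
  simp
  ring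

/-- Cutting a bounded solution `u` of `Δu = -λu` off at radius `R` produces an error `O(1/R)`
in this equation, uniformly in space. -/
theorem exists_laplacian_cutoff_bound {E : Type*} [NormedAddCommGroup E] [InnerProductSpace ℝ E]
    [FiniteDimensional ℝ E] {u η : E → ℝ} (hu : ContDiff ℝ 2 u) (hη : ContDiff ℝ 2 η)
    (hηs : HasCompactSupport η) {lam A B : ℝ} (hA : ∀ x, |u x| ≤ A) (hB : ∀ x, ‖fderiv ℝ u x‖ ≤ B)
    (hΔ : ∀ x, Laplacian.laplacian u x = -lam * u x) :
    ∃ K, ∀ R : ℝ, 1 ≤ R → ∀ x,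
      |Laplacian.laplacian (fun y => u y * η (R⁻¹ • y)) x + lam * (u x * η (R⁻¹ • x))| ≤ K / R := by
  obtain ⟨B', hB'⟩ := (hη.continuous_fderiv (by norm_num)).bounded_above_of_compact_support
    (hηs.fderiv ℝ)
  have hlap : Laplacian.laplacian η = fun x => ∑ i, fderiv ℝ (fderiv ℝ η) x
      (stdOrthonormalBasis ℝ E i) (stdOrthonormalBasis ℝ E i) := by
    simp [InnerProductSpace.laplacian_eq_iteratedFDeriv_stdOrthonormalBasis,
      iteratedFDeriv_two_apply]
  obtain ⟨D', hD'⟩ := ((hη.fderiv_right (m := 1) (by norm_num)).continuous_fderiv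
    (by norm_num)).bounded_above_of_compact_support ((hηs.fderiv ℝ).fderiv ℝ)
  set d := (Finset.univ : Finset (Fin (Module.finrank ℝ E))).card
  have hA0 : 0 ≤ A := (abs_nonneg _).trans (hA 0)
  have hB0 : 0 ≤ B := (norm_nonneg _).trans (hB 0)
  have hB'0 : 0 ≤ B' := (norm_nonneg _).trans (hB' 0)
  have hD'0 : 0 ≤ D' := (norm_nonneg _).trans (hD' 0)
  refine ⟨A * (d * D') + 2 * (d * (B * B')), fun R hR x => ?_⟩
  have hR0 : 0 < R := by linarith
  have hη' : ContDiff ℝ 2 (fun y => η (R⁻¹ • y)) := hη.comp (contDiff_const_smul _)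
  rw [laplacian_mul hu hη', laplacian_scale hη, hΔ, fderiv_scale]
  have e1 : |Laplacian.laplacian η (R⁻¹ • x)| ≤ d * D' := by
    rw [hlap]
    refine (Finset.abs_sum_le_sum_abs _ _).trans ?_
    rw [← nsmul_eq_mul]
    refine Finset.sum_le_card_nsmul _ _ _ fun i _ => ?_
    refine (((fderiv ℝ (fderiv ℝ η) (R⁻¹ • x)) _).le_opNorm _).trans ?_
    refine (mul_le_mul_of_nonneg_right ((fderiv ℝ (fderiv ℝ η) (R⁻¹ • x)).le_opNorm _)
      (norm_nonneg _)).trans ?_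
    simpa using hD' _
  have e2 : |∑ i, fderiv ℝ u x (stdOrthonormalBasis ℝ E i) *
      (fderiv ℝ η (R⁻¹ • x)) (stdOrthonormalBasis ℝ E i)| ≤ d * (B * B') := by
    refine (Finset.abs_sum_le_sum_abs _ _).trans ?_
    rw [← nsmul_eq_mul]
    refine Finset.sum_le_card_nsmul _ _ _ fun i _ => ?_
    rw [abs_mul]
    refine mul_le_mul ?_ ?_ (abs_nonneg _) hB0
    · refine ((fderiv ℝ u x).le_opNorm _).trans ?_
      simpa using hB x
    · refine ((fderiv ℝ η (R⁻¹ • x)).le_opNorm _).trans ?_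
      simpa using hB' _
  have e3 : (R⁻¹) ^ 2 ≤ R⁻¹ := by
    have : R⁻¹ ≤ 1 := inv_le_one_of_one_le₀ hR
    have h0 : 0 < R⁻¹ := inv_pos.2 hR0
    nlinarith
  have e4 : u x * (R⁻¹ ^ 2 * Laplacian.laplacian η (R⁻¹ • x)) + η (R⁻¹ • x) * (-lam * u x) +
      2 * ∑ i, fderiv ℝ u x (stdOrthonormalBasis ℝ E i) *
        (R⁻¹ • fderiv ℝ η (R⁻¹ • x)) (stdOrthonormalBasis ℝ E i) + lam * (u x * η (R⁻¹ • x)) =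
      R⁻¹ ^ 2 * (u x * Laplacian.laplacian η (R⁻¹ • x)) +
      R⁻¹ * (2 * ∑ i, fderiv ℝ u x (stdOrthonormalBasis ℝ E i) *
        (fderiv ℝ η (R⁻¹ • x)) (stdOrthonormalBasis ℝ E i)) := by
    have : ∑ i, fderiv ℝ u x (stdOrthonormalBasis ℝ E i) *
        (R⁻¹ • fderiv ℝ η (R⁻¹ • x)) (stdOrthonormalBasis ℝ E i) =
        R⁻¹ * ∑ i, fderiv ℝ u x (stdOrthonormalBasis ℝ E i) *
        (fderiv ℝ η (R⁻¹ • x)) (stdOrthonormalBasis ℝ E i) := by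
      rw [Finset.mul_sum]
      refine Finset.sum_congr rfl fun i _ => ?_
      simp
      ring
    rw [this]
    ring
  rw [e4]
  have hRi : 0 ≤ R⁻¹ := by positivity
  calc _ ≤ R⁻¹ ^ 2 * (A * (d * D')) + R⁻¹ * (2 * (d * (B * B'))) := by
        refine (abs_add_le _ _).trans (add_le_add ?_ ?_)
        · rw [abs_mul, abs_mul, abs_of_nonneg (by positivity : 0 ≤ R⁻¹ ^ 2)]
          exact mul_le_mul_of_nonneg_left (mul_le_mul (hA x) e1 (abs_nonneg _) hA0) (by positivity)
        · rw [abs_mul, abs_mul, abs_of_nonneg hRi, abs_of_pos (by norm_num : (0:ℝ) < 2)]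
          gcongr
    _ ≤ R⁻¹ * (A * (d * D')) + R⁻¹ * (2 * (d * (B * B'))) := by gcongr
    _ = _ := by ring

/-! ### The Fourier transform of a weak solution of the heat equation -/

/-- A weak solution of the heat equation may be tested against a bounded eigenfunction `u` of the
Laplacian: the eigenfunction is cut off at radius `R`, and the error is `O(1/R)` because the
solution is bounded in `L¹`. -/
theorem IsHeatSolution.integral_mul_eigenfunction {n : ℕ} {f : ℝ → EuclideanSpace ℝ (Fin n) → ℝ}
    (hf : IsHeatSolution f) {u : EuclideanSpace ℝ (Fin n) → ℝ} (hu : ContDiff ℝ ∞ u)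
    {lam A B : ℝ} (hlam : 0 ≤ lam) (hA : ∀ x, |u x| ≤ A) (hB : ∀ x, ‖fderiv ℝ u x‖ ≤ B)
    (hΔ : ∀ x, Laplacian.laplacian u x = -lam * u x) {t : ℝ} (ht : 0 < t) :
    ∫ x, f t x * u x = Real.exp (-(lam * t)) * ∫ x, f 0 x * u x := by
  -- the cutoff: `η = 1` on the unit ball, `η = 0` outside the ball of radius two
  let η : ContDiffBump (0 : EuclideanSpace ℝ (Fin n)) := ⟨1, 2, by norm_num, by norm_num⟩
  have hη : ContDiff ℝ ∞ η := η.contDiff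
  have hηs : HasCompactSupport η := η.hasCompactSupport
  obtain ⟨K, hK⟩ := exists_laplacian_cutoff_bound (hu.of_le (by norm_cast))
    (hη.of_le (by norm_cast)) hηs hA hB hΔ
  obtain ⟨M, hM⟩ := hf.bounded t ht.le
  have hK0 : 0 ≤ K := by
    have := (abs_nonneg _).trans (hK 1 le_rfl 0)
    simpa using this
  have hA0 : 0 ≤ A := (abs_nonneg _).trans (hA 0)
  have hM0 : 0 ≤ M := (integral_nonneg fun _ => abs_nonneg _).trans (hM 0 le_rfl ht.le)
  let φ : ℝ → EuclideanSpace ℝ (Fin n) → ℝ := fun R y => u y * η (R⁻¹ • y)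
  have hφ : ∀ R, ContDiff ℝ ∞ (φ R) := fun R => hu.mul (hη.comp (contDiff_const_smul _))
  have hφs : ∀ R : ℝ, 1 ≤ R → HasCompactSupport (φ R) := fun R hR =>
    (hηs.comp_smul (inv_ne_zero (by linarith : R ≠ 0))).mul_left
  have hφΔ : ∀ R, Continuous (Laplacian.laplacian (φ R)) := by
    intro R
    have : ContDiff ℝ 2 (φ R) := (hφ R).of_le (by norm_cast)
    have h2 : Continuous (fderiv ℝ (fderiv ℝ (φ R))) :=
      (this.fderiv_right (m := 1) (by norm_num)).continuous_fderiv (by norm_num)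
    rw [InnerProductSpace.laplacian_eq_iteratedFDeriv_stdOrthonormalBasis]
    simp only [iteratedFDeriv_two_apply, Matrix.cons_val_zero, Matrix.cons_val_one]
    fun_prop
  have hφA : ∀ R x, ‖φ R x‖ ≤ A := by
    intro R x
    rw [norm_mul, Real.norm_eq_abs, Real.norm_eq_abs, abs_of_nonneg η.nonneg]
    calc _ ≤ A * 1 := mul_le_mul (hA x) η.le_one η.nonneg hA0
      _ = A := mul_one A
  have hint : ∀ s, 0 ≤ s → ∀ R, Integrable fun x => f s x * φ R x := fun s hs R =>
    (hf.integrable s hs).mul_bdd (hφ R).continuous.aestronglyMeasurable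
      (Eventually.of_forall (hφA R))
  -- the mean value inequality for `s ↦ exp (λ s) ∫ f s φ_R`
  have hmv : ∀ R : ℝ, 1 ≤ R → ∀ ε, 0 < ε → ε ≤ t →
      ‖Real.exp (lam * t) * (∫ x, f t x * φ R x) - Real.exp (lam * ε) * ∫ x, f ε x * φ R x‖ ≤
        Real.exp (lam * t) * (M * (K / R)) * t := by
    intro R hR ε hε hεt
    have hR0 : 0 < R := by linarith
    have hd : ∀ s, 0 < s → HasDerivAt (fun s => Real.exp (lam * s) * ∫ x, f s x * φ R x)
        (Real.exp (lam * s) * lam * (∫ x, f s x * φ R x) +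
          Real.exp (lam * s) * ∫ x, f s x * Laplacian.laplacian (φ R) x) s := by
      intro s hs
      have h1 : HasDerivAt (fun s => Real.exp (lam * s)) (Real.exp (lam * s) * lam) s := by
        simpa using ((hasDerivAt_id s).const_mul lam).exp
      exact h1.mul (hf.equation _ (hφ R) (hφs R hR) s hs)
    have hbound : ∀ s ∈ Set.Icc ε t, ‖Real.exp (lam * s) * lam * (∫ x, f s x * φ R x) +
          Real.exp (lam * s) * ∫ x, f s x * Laplacian.laplacian (φ R) x‖ ≤
        Real.exp (lam * t) * (M * (K / R)) := by
      intro s hs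
      have hs0 : 0 ≤ s := hε.le.trans hs.1
      have hb : ∀ x, |Laplacian.laplacian (φ R) x + lam * φ R x| ≤ K / R := hK R hR
      have hi2 : Integrable fun x => f s x * (Laplacian.laplacian (φ R) x + lam * φ R x) :=
        (hf.integrable s hs0).mul_bdd
          ((hφΔ R).add ((hφ R).continuous.const_mul lam)).aestronglyMeasurable
          (Eventually.of_forall hb)
      have hi1 : Integrable fun x => f s x * Laplacian.laplacian (φ R) x := by
        have := hi2.sub ((hint s hs0 R).const_mul lam)
        refine this.congr (Eventually.of_forall fun x => ?_)
        simp only [Pi.sub_apply]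
        ring
      have e1 : Real.exp (lam * s) * lam * (∫ x, f s x * φ R x) +
          Real.exp (lam * s) * ∫ x, f s x * Laplacian.laplacian (φ R) x =
          Real.exp (lam * s) * ∫ x, f s x * (Laplacian.laplacian (φ R) x + lam * φ R x) := by
        have : ∫ x, f s x * (Laplacian.laplacian (φ R) x + lam * φ R x) =
            (∫ x, f s x * Laplacian.laplacian (φ R) x) + lam * ∫ x, f s x * φ R x := by
          rw [← integral_const_mul, ← integral_add hi1 ((hint s hs0 R).const_mul lam)]
          congr 1
          funext x
          ring
        rw [this]
        ring
      rw [e1, norm_mul, Real.norm_of_nonneg (Real.exp_pos _).le]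
      refine mul_le_mul (Real.exp_le_exp.2 (mul_le_mul_of_nonneg_left hs.2 hlam)) ?_
        (norm_nonneg _) (Real.exp_pos _).le
      calc _ ≤ ∫ x, |f s x| * (K / R) := by
            refine norm_integral_le_of_norm_le ((hf.integrable s hs0).abs.mul_const _)
              (Eventually.of_forall fun x => ?_)
            rw [norm_mul]
            exact mul_le_mul_of_nonneg_left (hb x) (abs_nonneg _)
        _ = (∫ x, |f s x|) * (K / R) := integral_mul_const _ _
        _ ≤ M * (K / R) := mul_le_mul_of_nonneg_right (hM s hs0 hs.2) (by positivity)
    have := (convex_Icc ε t).norm_image_sub_le_of_norm_hasDerivWithin_le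
      (fun s hs => (hd s (hε.trans_le hs.1)).hasDerivWithinAt) hbound
      (Set.left_mem_Icc.2 hεt) (Set.right_mem_Icc.2 hεt)
    refine this.trans ?_
    rw [Real.norm_of_nonneg (by linarith)]
    gcongr
    linarith
  have hmv0 : ∀ R : ℝ, 1 ≤ R →
      ‖Real.exp (lam * t) * (∫ x, f t x * φ R x) - ∫ x, f 0 x * φ R x‖ ≤
        Real.exp (lam * t) * (M * (K / R)) * t := by
    intro R hR
    have h1 : Tendsto (fun ε => Real.exp (lam * ε) * ∫ x, f ε x * φ R x) (𝓝[>] 0)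
        (𝓝 (Real.exp (lam * 0) * ∫ x, f 0 x * φ R x)) :=
      ((by fun_prop : Continuous fun ε => Real.exp (lam * ε)).tendsto 0 |>.mono_left
        nhdsWithin_le_nhds).mul (hf.initial _ (hφ R) (hφs R hR))
    rw [mul_zero, Real.exp_zero, one_mul] at h1
    refine le_of_tendsto (tendsto_const_nhds.sub h1).norm ?_
    filter_upwards [Ioc_mem_nhdsGT ht] with ε hε
    exact hmv R hR ε hε.1 hε.2
  have hlim : ∀ s, 0 ≤ s → Tendsto (fun R => ∫ x, f s x * φ R x) atTop
      (𝓝 (∫ x, f s x * u x)) := by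
    intro s hs
    refine tendsto_integral_filter_of_dominated_convergence (fun x => |f s x| * A)
      (Eventually.of_forall fun R => (hint s hs R).aestronglyMeasurable) ?_
      ((hf.integrable s hs).abs.mul_const A) ?_
    · refine Eventually.of_forall fun R => Eventually.of_forall fun x => ?_
      rw [norm_mul]
      exact mul_le_mul_of_nonneg_left (hφA R x) (abs_nonneg _)
    · refine Eventually.of_forall fun x => ?_
      have h1 : Tendsto (fun R : ℝ => R⁻¹ • x) atTop (𝓝 ((0 : ℝ) • x)) :=
        tendsto_inv_atTop_zero.smul_const x
      rw [zero_smul] at h1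
      have h2 := (hη.continuous.tendsto 0).comp h1
      have h3 : η (0 : EuclideanSpace ℝ (Fin n)) = 1 :=
        η.one_of_mem_closedBall (by simp [η])
      rw [h3] at h2
      simpa using (h2.const_mul (u x)).const_mul (f s x)
  have hz : Tendsto (fun R : ℝ => Real.exp (lam * t) * (M * (K / R)) * t) atTop (𝓝 0) := by
    have : Tendsto (fun R : ℝ => K / R) atTop (𝓝 0) := tendsto_const_nhds.div_atTop tendsto_id
    simpa using ((this.const_mul M).const_mul (Real.exp (lam * t))).mul_const t
  have hfin : ‖Real.exp (lam * t) * (∫ x, f t x * u x) - ∫ x, f 0 x * u x‖ ≤ 0 :=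
    le_of_tendsto_of_tendsto (((hlim t ht.le).const_mul _).sub (hlim 0 le_rfl)).norm hz
      ((eventually_ge_atTop 1).mono hmv0)
  have := sub_eq_zero.1 (norm_le_zero_iff.1 hfin)
  rw [← this, ← mul_assoc, ← Real.exp_add]
  simp

/-- In Fourier variables, the heat flow is multiplication by `exp (-t |ξ|²)`. -/
theorem IsHeatSolution.fourierHat_eq {n : ℕ} {f : ℝ → EuclideanSpace ℝ (Fin n) → ℝ}
    (hf : IsHeatSolution f) {t : ℝ} (ht : 0 < t) (ξ : EuclideanSpace ℝ (Fin n)) :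
    fourierHat (f t) ξ = Complex.exp (-(t * ‖ξ‖ ^ 2 : ℝ)) * fourierHat (f 0) ξ := by
  have hcos : ∀ θ : ℝ, ∫ x, f t x * Real.cos (inner ℝ ξ x - θ) =
      Real.exp (-(‖ξ‖ ^ 2 * t)) * ∫ x, f 0 x * Real.cos (inner ℝ ξ x - θ) := by
    intro θ
    have hu : ContDiff ℝ ∞ fun x => Real.cos (inner ℝ ξ x - θ) :=
      Real.contDiff_cos.comp ((contDiff_const.inner ℝ contDiff_id).sub contDiff_const)
    refine hf.integral_mul_eigenfunction (A := 1) (B := ‖ξ‖) hu (by positivity)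
      (fun x => Real.abs_cos_le_one _) (fun x => ?_) (laplacian_cos_inner ξ θ) ht
    have hd : HasFDerivAt (fun y => Real.cos (inner ℝ ξ y - θ))
        ((-Real.sin (inner ℝ ξ x - θ)) • innerSL ℝ ξ) x :=
      ((innerSL ℝ ξ).hasFDerivAt.sub_const θ).cos
    rw [hd.fderiv, norm_smul, innerSL_apply_norm]
    have := Real.abs_sin_le_one (inner ℝ ξ x - θ)
    rw [norm_neg, Real.norm_eq_abs]
    exact mul_le_of_le_one_left (norm_nonneg _) this
  have hrepr : ∀ s, 0 ≤ s → fourierHat (f s) ξ =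
      ((∫ x, f s x * Real.cos (inner ℝ ξ x - 0) : ℝ) : ℂ) -
        Complex.I * ((∫ x, f s x * Real.cos (inner ℝ ξ x - Real.pi / 2) : ℝ) : ℂ) := by
    intro s hs
    have hi : ∀ θ : ℝ, Integrable fun x => ((f s x * Real.cos (inner ℝ ξ x - θ) : ℝ) : ℂ) :=
      fun θ => ((hf.integrable s hs).mul_bdd (by fun_prop)
        (Eventually.of_forall fun x => Real.abs_cos_le_one _)).ofReal
    rw [← integral_complex_ofReal, ← integral_complex_ofReal, ← integral_const_mul,
      ← integral_sub (hi 0) ((hi _).const_mul _)]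
    refine integral_congr_ae (Eventually.of_forall fun x => ?_)
    simp only [sub_zero, Real.cos_sub_pi_div_two]
    rw [show -Complex.I * ((inner ℝ ξ x : ℝ) : ℂ) = ((-(inner ℝ ξ x : ℝ) : ℝ) : ℂ) * Complex.I by
      push_cast; ring, Complex.exp_mul_I]
    push_cast
    simp
    ring
  rw [hrepr t ht.le, hrepr 0 le_rfl, hcos, hcos]
  push_cast
  rw [mul_comm ((‖ξ‖ : ℂ) ^ 2)]
  ring

/-! ### Gaussian interactions in Fourier variables -/

/-- Fubini's theorem for a nonnegative function whose integrals along one family of fibres are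
known: no separate proof of joint integrability is needed. -/
theorem integral_swap_of_nonneg {X Y : Type*} [MeasurableSpace X] [MeasurableSpace Y]
    {ρ : Measure X} {σ : Measure Y} [SFinite ρ] [SFinite σ] {F : X → Y → ℝ} {Φ : X → ℝ}
    (hF : AEStronglyMeasurable (Function.uncurry F) (ρ.prod σ))
    (h0 : ∀ᵐ x ∂ρ, ∀ᵐ y ∂σ, 0 ≤ F x y)
    (h1 : ∀ᵐ x ∂ρ, Integrable (F x) σ) (h2 : ∀ᵐ x ∂ρ, ∫ y, F x y ∂σ = Φ x)
    (hΦ : Integrable Φ ρ) :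
    Integrable (fun y => ∫ x, F x y ∂ρ) σ ∧ ∫ y, ∫ x, F x y ∂ρ ∂σ = ∫ x, Φ x ∂ρ := by
  have hint : Integrable (Function.uncurry F) (ρ.prod σ) := by
    refine (integrable_prod_iff hF).2 ⟨h1, hΦ.congr ?_⟩
    filter_upwards [h0, h2] with x hx hx2
    rw [← hx2]
    refine integral_congr_ae ?_
    filter_upwards [hx] with y hy
    exact (Real.norm_of_nonneg hy).symm
  refine ⟨hint.integral_prod_right, ?_⟩
  rw [← integral_integral_swap hint]
  exact integral_congr_ae h2

theorem integrableOn_rpow_mul_exp_neg_mul {b c : ℝ} (hb : 0 < b) (hc : 0 < c) :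
    IntegrableOn (fun τ : ℝ => τ ^ (b - 1) * Real.exp (-(c * τ))) (Set.Ioi 0) := by
  have := integrableOn_rpow_mul_exp_neg_mul_rpow (p := 1) (s := b - 1) (b := c) (by linarith)
    one_pos hc
  simpa using this

theorem integral_rpow_mul_exp_neg_mul {b c : ℝ} (hb : 0 < b) (hc : 0 < c) :
    ∫ τ in Set.Ioi (0 : ℝ), τ ^ (b - 1) * Real.exp (-(c * τ)) = Real.Gamma b * c ^ (-b) := by
  rw [Real.integral_rpow_mul_exp_neg_mul_Ioi hb hc, one_div, Real.inv_rpow hc.le,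
    Real.rpow_neg hc.le, mul_comm]

/-- The Gamma integral in the variable `1/τ`. -/
theorem integral_rpow_mul_exp_neg_div {b c : ℝ} (hb : 0 < b) (hc : 0 < c) :
    ∫ τ in Set.Ioi (0 : ℝ), τ ^ (-b - 1) * Real.exp (-(c / τ)) = Real.Gamma b * c ^ (-b) := by
  rw [← integral_rpow_mul_exp_neg_mul hb hc,
    ← integral_comp_rpow_Ioi (fun τ : ℝ => τ ^ (b - 1) * Real.exp (-(c * τ)))
      (by norm_num : (-1 : ℝ) ≠ 0)]
  refine setIntegral_congr_fun measurableSet_Ioi fun τ hτ => ?_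
  have hτ0 : (0 : ℝ) < τ := hτ
  simp only [smul_eq_mul, abs_neg, abs_one, one_mul]
  rw [← Real.rpow_mul hτ0.le, ← mul_assoc, ← Real.rpow_add hτ0, Real.rpow_neg_one]
  congr 2
  ring

/-- `∫₀^∞ τ^{-a-1} (1 - e^{-Rτ}) dτ = Γ(1-a) R^a / a`, by integrating
`∫₀^∞ τ^{-a} e^{-sτ} dτ = Γ(1-a) s^{a-1}` over `0 < s < R`. -/
theorem integral_rpow_mul_one_sub_exp {a R : ℝ} (ha0 : 0 < a) (ha1 : a < 1) (hR : 0 ≤ R) :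
    IntegrableOn (fun τ : ℝ => τ ^ (-a - 1) * (1 - Real.exp (-(R * τ)))) (Set.Ioi 0) ∧
    ∫ τ in Set.Ioi (0 : ℝ), τ ^ (-a - 1) * (1 - Real.exp (-(R * τ))) =
      Real.Gamma (1 - a) / a * R ^ a := by
  have hinner : ∀ τ ∈ Set.Ioi (0 : ℝ),
      ∫ s in Set.Ioc 0 R, τ ^ (1 - a - 1) * Real.exp (-(s * τ)) =
        τ ^ (-a - 1) * (1 - Real.exp (-(R * τ))) := by
    intro τ hτ
    have hτ0 : (0 : ℝ) < τ := hτ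
    rw [← intervalIntegral.integral_of_le hR, intervalIntegral.integral_const_mul,
      intervalIntegral.integral_eq_sub_of_hasDerivAt
        (f := fun s => -(τ⁻¹ * Real.exp (-(s * τ)))) (fun s _ => ?_) (by
          apply Continuous.intervalIntegrable; fun_prop)]
    · rw [show (1 - a - 1 : ℝ) = -a by ring, Real.rpow_sub_one hτ0.ne']
      simp
      ring
    · have h := ((((hasDerivAt_id s).mul_const τ).neg.exp).const_mul τ⁻¹).neg
      refine h.congr_deriv ?_
      simp
      field_simp
  have hΦi : IntegrableOn (fun s : ℝ => Real.Gamma (1 - a) * s ^ (-(1 - a))) (Set.Ioc 0 R) := by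
    have := (intervalIntegral.intervalIntegrable_rpow' (a := 0) (b := R) (r := -(1 - a))
      (by linarith)).const_mul (Real.Gamma (1 - a))
    rwa [intervalIntegrable_iff_integrableOn_Ioc_of_le hR] at this
  have key := integral_swap_of_nonneg (ρ := volume.restrict (Set.Ioc 0 R))
    (σ := volume.restrict (Set.Ioi (0 : ℝ)))
    (F := fun s τ => τ ^ (1 - a - 1) * Real.exp (-(s * τ)))
    (Φ := fun s => Real.Gamma (1 - a) * s ^ (-(1 - a)))
    (by
      refine Measurable.aestronglyMeasurable ?_
      unfold Function.uncurry
      fun_prop)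
    (by
      refine Eventually.of_forall fun s => ?_
      filter_upwards [ae_restrict_mem measurableSet_Ioi] with τ hτ
      have hτ0 : (0 : ℝ) < τ := hτ
      positivity)
    (by
      filter_upwards [ae_restrict_mem measurableSet_Ioc] with s hs
      exact integrableOn_rpow_mul_exp_neg_mul (by linarith) hs.1)
    (by
      filter_upwards [ae_restrict_mem measurableSet_Ioc] with s hs
      exact integral_rpow_mul_exp_neg_mul (by linarith) hs.1) hΦi
  refine ⟨(integrableOn_congr_fun hinner measurableSet_Ioi).1 key.1, ?_⟩
  rw [← setIntegral_congr_fun measurableSet_Ioi hinner, key.2, integral_const_mul,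
    ← intervalIntegral.integral_of_le hR, integral_rpow (Or.inl (by linarith)),
    show -(1 - a) + 1 = a by ring, Real.zero_rpow ha0.ne', sub_zero]
  ring

section Gauss

variable {E : Type*} [NormedAddCommGroup E] [InnerProductSpace ℝ E] [FiniteDimensional ℝ E]
  [MeasurableSpace E] [BorelSpace E]

/-- The Gaussian interaction `∬ exp (-τ |x-y|²) dμ(x) dν(y)`. -/
def gaussInteraction (τ : ℝ) (μ ν : Measure E) : ℝ :=
  ∫ p : E × E, Real.exp (-(‖p.1 - p.2‖ ^ 2 * τ)) ∂(μ.prod ν)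

theorem integrable_gauss {b : ℝ} (hb : 0 < b) :
    Integrable fun ξ : E => Real.exp (-(b * ‖ξ‖ ^ 2)) := by
  have := (GaussianFourier.integrable_cexp_neg_mul_sq_norm_add (V := E) (b := b) (by simpa) 0 0).re
  refine this.congr (Eventually.of_forall fun ξ => ?_)
  simp only [inner_zero_left, Complex.ofReal_zero, mul_zero, add_zero]
  rw [show (-(b : ℂ) * (‖ξ‖ : ℂ) ^ 2) = ((-(b * ‖ξ‖ ^ 2) : ℝ) : ℂ) by push_cast; ring,
    ← Complex.ofReal_exp]
  rfl

/-- Parseval's identity for the Gaussian interaction: the Gaussian is the Fourier transform of a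
Gaussian, and Fubini's theorem turns the integrals in `x` and `y` into characteristic functions. -/
theorem gaussInteraction_eq {τ : ℝ} (hτ : 0 < τ) (μ ν : Measure E) [IsFiniteMeasure μ]
    [IsFiniteMeasure ν] :
    (gaussInteraction τ μ ν : ℂ) = ((4 * Real.pi * τ) ^ (-((Module.finrank ℝ E : ℝ) / 2)) : ℝ) *
      ∫ ξ : E, (Real.exp (-((4 * τ)⁻¹ * ‖ξ‖ ^ 2)) : ℂ) *
        (charFun μ ξ * (starRingEnd ℂ) (charFun ν ξ)) := by
  have hb : 0 < (4 * τ)⁻¹ := by positivity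
  set c : ℝ := (4 * Real.pi * τ) ^ (-((Module.finrank ℝ E : ℝ) / 2)) with hc
  have hpt : ∀ p : E × E, ((Real.exp (-(‖p.1 - p.2‖ ^ 2 * τ)) : ℝ) : ℂ) =
      c * ∫ ξ : E, Complex.exp (-(((4 * τ)⁻¹ : ℝ) : ℂ) * (‖ξ‖ : ℂ) ^ 2 +
        Complex.I * ((inner ℝ (p.1 - p.2) ξ : ℝ) : ℂ)) := by
    intro p
    rw [GaussianFourier.integral_cexp_neg_mul_sq_norm_add (by simpa using hτ)]
    have e1 : ((Real.pi : ℂ) / (((4 * τ)⁻¹ : ℝ) : ℂ)) = ((4 * Real.pi * τ : ℝ) : ℂ) := by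
      push_cast
      field_simp
    have e2 : ((Module.finrank ℝ E : ℂ) / 2) = (((Module.finrank ℝ E : ℝ) / 2 : ℝ) : ℂ) := by
      push_cast; ring
    have hp : (0 : ℝ) < 4 * Real.pi * τ := by positivity
    rw [e1, e2, ← Complex.ofReal_cpow hp.le, ← mul_assoc, ← Complex.ofReal_mul, hc,
      ← Real.rpow_add hp, neg_add_cancel, Real.rpow_zero, Complex.ofReal_one, one_mul,
      Complex.ofReal_exp, Complex.I_sq]
    congr 1
    have : (τ : ℂ) ≠ 0 := by exact_mod_cast hτ.ne'
    push_cast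
    field_simp
  have hsplit : ∀ (p : E × E) (ξ : E), Complex.exp (-(((4 * τ)⁻¹ : ℝ) : ℂ) * (‖ξ‖ : ℂ) ^ 2 +
        Complex.I * ((inner ℝ (p.1 - p.2) ξ : ℝ) : ℂ)) =
      (Real.exp (-((4 * τ)⁻¹ * ‖ξ‖ ^ 2)) : ℂ) *
        (Complex.exp ((inner ℝ p.1 ξ : ℝ) * Complex.I) *
          (starRingEnd ℂ) (Complex.exp ((inner ℝ p.2 ξ : ℝ) * Complex.I))) := by
    intro p ξ
    rw [← Complex.exp_conj, ← Complex.exp_add, Complex.ofReal_exp, ← Complex.exp_add,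
      inner_sub_left]
    congr 1
    simp
    ring
  have hint : Integrable (Function.uncurry fun (p : E × E) (ξ : E) =>
      Complex.exp (-(((4 * τ)⁻¹ : ℝ) : ℂ) * (‖ξ‖ : ℂ) ^ 2 +
        Complex.I * ((inner ℝ (p.1 - p.2) ξ : ℝ) : ℂ))) ((μ.prod ν).prod volume) := by
    have h1 : Integrable (fun q : (E × E) × E => (1 : ℝ) * Real.exp (-((4 * τ)⁻¹ * ‖q.2‖ ^ 2)))
        ((μ.prod ν).prod volume) := (integrable_const (1 : ℝ)).mul_prod (integrable_gauss hb)
    refine h1.mono' (Continuous.aestronglyMeasurable (by unfold Function.uncurry; fun_prop))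
      (Eventually.of_forall fun q => ?_)
    unfold Function.uncurry
    dsimp only
    rw [hsplit, norm_mul, norm_mul, RCLike.norm_conj, Complex.norm_exp_ofReal_mul_I,
      Complex.norm_exp_ofReal_mul_I, Complex.norm_real, Real.norm_of_nonneg (Real.exp_pos _).le]
    simp
  have hin : ∀ ξ : E, ∫ p : E × E, Complex.exp (-(((4 * τ)⁻¹ : ℝ) : ℂ) * (‖ξ‖ : ℂ) ^ 2 +
        Complex.I * ((inner ℝ (p.1 - p.2) ξ : ℝ) : ℂ)) ∂(μ.prod ν) =
      (Real.exp (-((4 * τ)⁻¹ * ‖ξ‖ ^ 2)) : ℂ) *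
        (charFun μ ξ * (starRingEnd ℂ) (charFun ν ξ)) := by
    intro ξ
    simp only [hsplit]
    rw [integral_const_mul, charFun_apply, charFun_apply, ← integral_conj, ← integral_prod_mul]
  rw [gaussInteraction, ← integral_complex_ofReal]
  simp only [hpt]
  rw [integral_const_mul, integral_integral_swap hint]
  simp only [hin]

/-- The Gaussian interaction energy of the signed measure `μ - ν`. -/
def gaussEnergy (τ : ℝ) (μ ν : Measure E) : ℝ :=
  gaussInteraction τ μ μ + gaussInteraction τ ν ν - 2 * gaussInteraction τ μ ν

theorem integrable_gauss_mul_charFun {b : ℝ} (hb : 0 < b) (μ ν : Measure E) [IsFiniteMeasure μ]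
    [IsFiniteMeasure ν] : Integrable fun ξ : E =>
      (Real.exp (-(b * ‖ξ‖ ^ 2)) : ℂ) * (charFun μ ξ * (starRingEnd ℂ) (charFun ν ξ)) := by
  refine (integrable_gauss hb).ofReal.mul_bdd (c := μ.real Set.univ * ν.real Set.univ) ?_ ?_
  · exact (measurable_charFun.mul
      (Complex.continuous_conj.measurable.comp measurable_charFun)).aestronglyMeasurable
  · refine Eventually.of_forall fun ξ => ?_
    rw [norm_mul, RCLike.norm_conj]
    exact mul_le_mul (norm_charFun_le _) (norm_charFun_le _) (norm_nonneg _) (by positivity)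

/-- The Gaussian energy is a Gaussian-weighted `L²` distance of characteristic functions. -/
theorem gaussEnergy_eq {τ : ℝ} (hτ : 0 < τ) (μ ν : Measure E) [IsFiniteMeasure μ]
    [IsFiniteMeasure ν] :
    gaussEnergy τ μ ν = (4 * Real.pi * τ) ^ (-((Module.finrank ℝ E : ℝ) / 2)) *
      ∫ ξ : E, Real.exp (-((4 * τ)⁻¹ * ‖ξ‖ ^ 2)) * ‖charFun μ ξ - charFun ν ξ‖ ^ 2 := by
  have hb : 0 < (4 * τ)⁻¹ := by positivity
  have hre : ∀ μ ν : Measure E, IsFiniteMeasure μ → IsFiniteMeasure ν → gaussInteraction τ μ ν =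
      (4 * Real.pi * τ) ^ (-((Module.finrank ℝ E : ℝ) / 2)) *
      ∫ ξ : E, Real.exp (-((4 * τ)⁻¹ * ‖ξ‖ ^ 2)) *
        (charFun μ ξ * (starRingEnd ℂ) (charFun ν ξ)).re := by
    intro μ ν _ _
    have h := congrArg Complex.re (gaussInteraction_eq hτ μ ν)
    rw [Complex.ofReal_re, Complex.re_ofReal_mul] at h
    rw [h, ← RCLike.re_eq_complex_re, ← integral_re (integrable_gauss_mul_charFun hb μ ν)]
    simp only [RCLike.re_eq_complex_re, Complex.re_ofReal_mul]
  have hi : ∀ μ ν : Measure E, IsFiniteMeasure μ → IsFiniteMeasure ν → Integrable fun ξ : E =>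
      Real.exp (-((4 * τ)⁻¹ * ‖ξ‖ ^ 2)) * (charFun μ ξ * (starRingEnd ℂ) (charFun ν ξ)).re := by
    intro μ ν _ _
    refine (integrable_gauss_mul_charFun hb μ ν).re.congr (Eventually.of_forall fun ξ => ?_)
    simp only [RCLike.re_eq_complex_re, Complex.re_ofReal_mul]
  rw [gaussEnergy, hre μ μ inferInstance inferInstance, hre ν ν inferInstance inferInstance,
    hre μ ν inferInstance inferInstance]
  have : ∫ ξ : E, Real.exp (-((4 * τ)⁻¹ * ‖ξ‖ ^ 2)) * ‖charFun μ ξ - charFun ν ξ‖ ^ 2 =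
      (∫ ξ : E, Real.exp (-((4 * τ)⁻¹ * ‖ξ‖ ^ 2)) *
        (charFun μ ξ * (starRingEnd ℂ) (charFun μ ξ)).re) +
      (∫ ξ : E, Real.exp (-((4 * τ)⁻¹ * ‖ξ‖ ^ 2)) *
        (charFun ν ξ * (starRingEnd ℂ) (charFun ν ξ)).re) -
      2 * ∫ ξ : E, Real.exp (-((4 * τ)⁻¹ * ‖ξ‖ ^ 2)) *
        (charFun μ ξ * (starRingEnd ℂ) (charFun ν ξ)).re := by
    have i1 := hi μ μ inferInstance inferInstance
    have i2 := hi ν ν inferInstance inferInstance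
    have i3 := hi μ ν inferInstance inferInstance
    rw [← integral_const_mul, ← integral_add i1 i2]
    refine Eq.trans ?_ (integral_sub (i1.add i2) (i3.const_mul 2))
    refine integral_congr_ae (Eventually.of_forall fun ξ => ?_)
    simp only [← Complex.normSq_eq_norm_sq, Complex.normSq_apply, Complex.mul_re,
      Complex.conj_re, Complex.conj_im, Complex.sub_re, Complex.sub_im]
    ring
  rw [this]
  ring

end Gauss

/-! ### Energies as mixtures of Gaussian interactions -/

section Energy

variable {E : Type*} [NormedAddCommGroup E] [InnerProductSpace ℝ E] [FiniteDimensional ℝ E]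
  [MeasurableSpace E] [BorelSpace E]

theorem integrable_exp_neg_norm_sub (μ ν : Measure E) [IsFiniteMeasure μ] [IsFiniteMeasure ν]
    {τ : ℝ} (hτ : 0 < τ) :
    Integrable (fun p : E × E => Real.exp (-(‖p.1 - p.2‖ ^ 2 * τ))) (μ.prod ν) := by
  refine Integrable.mono' (integrable_const (1 : ℝ))
    (Continuous.aestronglyMeasurable (by fun_prop)) (Eventually.of_forall fun p => ?_)
  rw [Real.norm_of_nonneg (Real.exp_pos _).le, Real.exp_le_one_iff]
  have : 0 ≤ ‖p.1 - p.2‖ ^ 2 * τ := by positivity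
  linarith

/-- Subordination: `|x-y|^{-2b}` is a mixture of Gaussians, for `b > 0`. -/
theorem rieszInteraction_eq {μ ν : Measure E} [IsFiniteMeasure μ] [IsFiniteMeasure ν] {b : ℝ}
    (hb : 0 < b) (hd : ∀ᵐ p ∂(μ.prod ν), p.1 ≠ p.2)
    (hI : Integrable (fun p : E × E => ‖p.1 - p.2‖ ^ (-(2 * b))) (μ.prod ν)) :
    IntegrableOn (fun τ : ℝ => τ ^ (b - 1) * gaussInteraction τ μ ν) (Set.Ioi 0) ∧
    ∫ τ in Set.Ioi (0 : ℝ), τ ^ (b - 1) * gaussInteraction τ μ ν =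
      Real.Gamma b * ∫ p : E × E, ‖p.1 - p.2‖ ^ (-(2 * b)) ∂(μ.prod ν) := by
  have hsq : ∀ p : E × E, (‖p.1 - p.2‖ ^ 2) ^ (-b) = ‖p.1 - p.2‖ ^ (-(2 * b)) := fun p => by
    rw [← Real.rpow_natCast, ← Real.rpow_mul (norm_nonneg _)]
    congr 1
    push_cast
    ring
  have key := integral_swap_of_nonneg (ρ := μ.prod ν) (σ := volume.restrict (Set.Ioi (0 : ℝ)))
    (F := fun p τ => τ ^ (b - 1) * Real.exp (-(‖p.1 - p.2‖ ^ 2 * τ)))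
    (Φ := fun p => Real.Gamma b * ‖p.1 - p.2‖ ^ (-(2 * b)))
    (by
      refine Measurable.aestronglyMeasurable ?_
      unfold Function.uncurry
      fun_prop)
    (by
      refine Eventually.of_forall fun s => ?_
      filter_upwards [ae_restrict_mem measurableSet_Ioi] with τ hτ
      have hτ0 : (0 : ℝ) < τ := hτ
      positivity)
    (by
      filter_upwards [hd] with p hp
      have : 0 < ‖p.1 - p.2‖ ^ 2 := by
        have := norm_pos_iff.2 (sub_ne_zero.2 hp)
        positivity
      exact integrableOn_rpow_mul_exp_neg_mul hb this)
    (by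
      filter_upwards [hd] with p hp
      have : 0 < ‖p.1 - p.2‖ ^ 2 := by
        have := norm_pos_iff.2 (sub_ne_zero.2 hp)
        positivity
      rw [integral_rpow_mul_exp_neg_mul hb this, hsq])
    (hI.const_mul _)
  simpa only [integral_const_mul, IntegrableOn, gaussInteraction] using key

/-- Subordination: `|x-y|^{2a}` is a mixture of the functions `1 - exp (-τ |x-y|²)`, for
`0 < a < 1`. -/
theorem powerInteraction_eq {μ ν : Measure E} [IsProbabilityMeasure μ] [IsProbabilityMeasure ν]
    {a : ℝ} (ha0 : 0 < a) (ha1 : a < 1)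
    (hI : Integrable (fun p : E × E => ‖p.1 - p.2‖ ^ (2 * a)) (μ.prod ν)) :
    IntegrableOn (fun τ : ℝ => τ ^ (-a - 1) * (1 - gaussInteraction τ μ ν)) (Set.Ioi 0) ∧
    ∫ τ in Set.Ioi (0 : ℝ), τ ^ (-a - 1) * (1 - gaussInteraction τ μ ν) =
      Real.Gamma (1 - a) / a * ∫ p : E × E, ‖p.1 - p.2‖ ^ (2 * a) ∂(μ.prod ν) := by
  have hsq : ∀ p : E × E, (‖p.1 - p.2‖ ^ 2) ^ a = ‖p.1 - p.2‖ ^ (2 * a) := fun p => by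
    rw [← Real.rpow_natCast, ← Real.rpow_mul (norm_nonneg _)]
    norm_num
  have key := integral_swap_of_nonneg (ρ := μ.prod ν) (σ := volume.restrict (Set.Ioi (0 : ℝ)))
    (F := fun p τ => τ ^ (-a - 1) * (1 - Real.exp (-(‖p.1 - p.2‖ ^ 2 * τ))))
    (Φ := fun p => Real.Gamma (1 - a) / a * ‖p.1 - p.2‖ ^ (2 * a))
    (by
      refine Measurable.aestronglyMeasurable ?_
      unfold Function.uncurry
      fun_prop)
    (by
      refine Eventually.of_forall fun p => ?_
      filter_upwards [ae_restrict_mem measurableSet_Ioi] with τ hτ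
      have hτ0 : (0 : ℝ) < τ := hτ
      refine mul_nonneg (by positivity) (sub_nonneg.2 (Real.exp_le_one_iff.2 ?_))
      have : 0 ≤ ‖p.1 - p.2‖ ^ 2 * τ := by positivity
      linarith)
    (Eventually.of_forall fun p => (integral_rpow_mul_one_sub_exp ha0 ha1 (by positivity)).1)
    (Eventually.of_forall fun p => by
      rw [(integral_rpow_mul_one_sub_exp ha0 ha1 (by positivity)).2, hsq])
    (hI.const_mul _)
  have hin : ∀ τ ∈ Set.Ioi (0 : ℝ),
      ∫ p : E × E, τ ^ (-a - 1) * (1 - Real.exp (-(‖p.1 - p.2‖ ^ 2 * τ))) ∂(μ.prod ν) =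
        τ ^ (-a - 1) * (1 - gaussInteraction τ μ ν) := by
    intro τ hτ
    rw [integral_const_mul, integral_sub (integrable_const _) (integrable_exp_neg_norm_sub μ ν hτ)]
    simp [gaussInteraction]
  refine ⟨(integrableOn_congr_fun hin measurableSet_Ioi).1 key.1, ?_⟩
  rw [← setIntegral_congr_fun measurableSet_Ioi hin, key.2, integral_const_mul]

/-- A mixture of the Gaussian energies `τ^{-a-1} dτ` is, in Fourier variables, the energy with
weight `|ξ|^{-(2a+N)}`. -/
theorem integral_gaussEnergy_eq [Nontrivial E] {μ ν : Measure E} [IsFiniteMeasure μ]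
    [IsFiniteMeasure ν] {a : ℝ} (ha : 0 < a + (Module.finrank ℝ E : ℝ) / 2)
    (hI : IntegrableOn (fun τ : ℝ => τ ^ (-a - 1) * gaussEnergy τ μ ν) (Set.Ioi 0)) :
    Integrable (fun ξ : E => ‖charFun μ ξ - charFun ν ξ‖ ^ 2 *
      ‖ξ‖ ^ (-(2 * a + Module.finrank ℝ E))) ∧
    ∫ τ in Set.Ioi (0 : ℝ), τ ^ (-a - 1) * gaussEnergy τ μ ν =
      (4 * Real.pi) ^ (-((Module.finrank ℝ E : ℝ) / 2)) *
        (Real.Gamma (a + (Module.finrank ℝ E : ℝ) / 2) * 4 ^ (a + (Module.finrank ℝ E : ℝ) / 2)) *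
        ∫ ξ : E, ‖charFun μ ξ - charFun ν ξ‖ ^ 2 * ‖ξ‖ ^ (-(2 * a + Module.finrank ℝ E)) := by
  set N : ℝ := (Module.finrank ℝ E : ℝ)
  set κ : ℝ := (4 * Real.pi) ^ (-(N / 2)) with hκ
  have hκ0 : 0 < κ := by positivity
  have hΓ : 0 < Real.Gamma (a + N / 2) := Real.Gamma_pos_of_pos ha
  have hbi : ∀ τ : ℝ, 0 < τ → Integrable fun ξ : E =>
      Real.exp (-((4 * τ)⁻¹ * ‖ξ‖ ^ 2)) * ‖charFun μ ξ - charFun ν ξ‖ ^ 2 := by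
    intro τ hτ
    refine (integrable_gauss (E := E) (by positivity : 0 < (4 * τ)⁻¹)).mul_bdd
      (c := (μ.real Set.univ + ν.real Set.univ) ^ 2)
      ((measurable_charFun.sub measurable_charFun).norm.pow_const 2).aestronglyMeasurable
      (Eventually.of_forall fun ξ => ?_)
    rw [Real.norm_of_nonneg (by positivity)]
    gcongr
    exact (norm_sub_le _ _).trans (add_le_add (norm_charFun_le _) (norm_charFun_le _))
  have key := integral_swap_of_nonneg (ρ := volume.restrict (Set.Ioi (0 : ℝ)))
    (σ := (volume : Measure E))
    (F := fun τ ξ => τ ^ (-(a + N / 2) - 1) * (Real.exp (-((4 * τ)⁻¹ * ‖ξ‖ ^ 2)) *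
      ‖charFun μ ξ - charFun ν ξ‖ ^ 2))
    (Φ := fun τ => κ⁻¹ * (τ ^ (-a - 1) * gaussEnergy τ μ ν))
    (by
      refine Measurable.aestronglyMeasurable ?_
      unfold Function.uncurry
      refine Measurable.mul (by fun_prop) (Measurable.mul (by fun_prop) ?_)
      exact (((measurable_charFun.sub measurable_charFun).norm.pow_const 2).comp measurable_snd))
    (by
      filter_upwards [ae_restrict_mem measurableSet_Ioi] with τ hτ
      have hτ0 : (0 : ℝ) < τ := hτ
      exact Eventually.of_forall fun ξ => by positivity)
    (by
      filter_upwards [ae_restrict_mem measurableSet_Ioi] with τ hτ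
      exact (hbi τ hτ).const_mul _)
    (by
      filter_upwards [ae_restrict_mem measurableSet_Ioi] with τ hτ
      have hτ0 : (0 : ℝ) < τ := hτ
      rw [integral_const_mul, gaussEnergy_eq hτ0, Real.mul_rpow (by positivity) hτ0.le, ← hκ,
        show -(a + N / 2) - 1 = (-a - 1) + -(N / 2) by ring, Real.rpow_add hτ0]
      field_simp
      exact mul_comm _ _)
    (hI.const_mul _)
  have hin : (fun ξ : E => ∫ τ in Set.Ioi (0 : ℝ), τ ^ (-(a + N / 2) - 1) *
      (Real.exp (-((4 * τ)⁻¹ * ‖ξ‖ ^ 2)) * ‖charFun μ ξ - charFun ν ξ‖ ^ 2)) =ᵐ[volume]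
      fun ξ => (Real.Gamma (a + N / 2) * 4 ^ (a + N / 2)) *
        (‖charFun μ ξ - charFun ν ξ‖ ^ 2 * ‖ξ‖ ^ (-(2 * a + N))) := by
    filter_upwards [compl_mem_ae_iff.2 (measure_singleton (0 : E))] with ξ hξ
    have hξ0 : 0 < ‖ξ‖ := norm_pos_iff.2 hξ
    have h1 : ∀ τ ∈ Set.Ioi (0 : ℝ), τ ^ (-(a + N / 2) - 1) *
        (Real.exp (-((4 * τ)⁻¹ * ‖ξ‖ ^ 2)) * ‖charFun μ ξ - charFun ν ξ‖ ^ 2) =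
        τ ^ (-(a + N / 2) - 1) * Real.exp (-((‖ξ‖ ^ 2 / 4) / τ)) *
          ‖charFun μ ξ - charFun ν ξ‖ ^ 2 := by
      intro τ hτ
      rw [mul_assoc]
      congr 4
      rw [mul_inv]
      ring
    rw [setIntegral_congr_fun measurableSet_Ioi h1, integral_mul_const,
      integral_rpow_mul_exp_neg_div ha (by positivity), Real.div_rpow (by positivity) (by norm_num),
      Real.rpow_neg (by norm_num : (0 : ℝ) ≤ 4), ← Real.rpow_natCast, ← Real.rpow_mul hξ0.le,
      show ((2 : ℕ) : ℝ) * -(a + N / 2) = -(2 * a + N) by push_cast; ring, div_inv_eq_mul]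
    ring
  have hc : Real.Gamma (a + N / 2) * 4 ^ (a + N / 2) ≠ 0 := by positivity
  refine ⟨(integrable_const_mul_iff (isUnit_iff_ne_zero.2 hc) _).1 (key.1.congr hin), ?_⟩
  have h2 := key.2
  rw [integral_congr_ae hin, integral_const_mul, integral_const_mul] at h2
  rw [mul_assoc, h2]
  field_simp

end Energy

/-! ### The energies in Fourier variables -/

section Energy

variable {E : Type*} [NormedAddCommGroup E] [InnerProductSpace ℝ E] [FiniteDimensional ℝ E]
  [MeasurableSpace E] [BorelSpace E]

theorem add_rpow_le_four_mul {α a b : ℝ} (hα0 : 0 ≤ α) (hα2 : α ≤ 2) (ha : 0 ≤ a) (hb : 0 ≤ b) :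
    (a + b) ^ α ≤ 4 * (a ^ α + b ^ α) := by
  wlog hab : a ≤ b generalizing a b
  · rw [add_comm a, add_comm (a ^ α)]
    exact this hb ha (le_of_not_ge hab)
  calc (a + b) ^ α ≤ (2 * b) ^ α := Real.rpow_le_rpow (by positivity) (by linarith) hα0
    _ = 2 ^ α * b ^ α := Real.mul_rpow (by norm_num) hb
    _ ≤ 2 ^ (2 : ℝ) * b ^ α := by gcongr; norm_num
    _ = 4 * b ^ α := by norm_num
    _ ≤ 4 * (a ^ α + b ^ α) := by
      have := Real.rpow_nonneg ha α
      linarith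

theorem integrable_norm_sub_rpow {μ ν : Measure E} [IsFiniteMeasure μ] [IsFiniteMeasure ν] {α : ℝ}
    (hα0 : 0 ≤ α) (hα2 : α ≤ 2) (hμ : Integrable (fun x => ‖x‖ ^ α) μ)
    (hν : Integrable (fun x => ‖x‖ ^ α) ν) :
    Integrable (fun p : E × E => ‖p.1 - p.2‖ ^ α) (μ.prod ν) := by
  refine (((hμ.comp_fst ν).add (hν.comp_snd μ)).const_mul 4).mono'
    (by fun_prop) (Eventually.of_forall fun p => ?_)
  rw [Real.norm_of_nonneg (by positivity)]
  exact (Real.rpow_le_rpow (norm_nonneg _) (norm_sub_le _ _) hα0).trans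
    (add_rpow_le_four_mul hα0 hα2 (norm_nonneg _) (norm_nonneg _))

theorem ae_prod_fst_ne_snd (μ ν : Measure E) [SFinite μ] [SFinite ν] [NullSingletonClass ν] :
    ∀ᵐ p ∂(μ.prod ν), p.1 ≠ p.2 := by
  have hm : MeasurableSet {p : E × E | p.1 ≠ p.2} :=
    (measurableSet_eq_fun measurable_fst measurable_snd).compl
  refine (Measure.ae_prod_iff_ae_ae hm).2 (Eventually.of_forall fun x => ?_)
  filter_upwards [compl_mem_ae_iff.2 (measure_singleton (μ := ν) x)] with y hy h
  exact hy h.symm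

end Energy

/-- The interaction `∬ |x-y|^s dμ(x) dν(y)` of two measures. -/
def measureInteraction {E : Type*} [NormedAddCommGroup E] [MeasurableSpace E] (s : ℝ)
    (μ ν : Measure E) : ℝ :=
  ∫ p : E × E, ‖p.1 - p.2‖ ^ s ∂(μ.prod ν)

/-- The energy distance of two measures. -/
def measureEnergy {E : Type*} [NormedAddCommGroup E] [MeasurableSpace E] (α : ℝ)
    (μ ν : Measure E) : ℝ :=
  2 * measureInteraction α μ ν - measureInteraction α μ μ - measureInteraction α ν ν

/-- The Riesz energy of order `-(2-α)` of the signed measure `μ - ν`. -/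
def measureNegEnergy {E : Type*} [NormedAddCommGroup E] [MeasurableSpace E] (α : ℝ)
    (μ ν : Measure E) : ℝ :=
  measureInteraction (-(2 - α)) μ μ + measureInteraction (-(2 - α)) ν ν -
    2 * measureInteraction (-(2 - α)) μ ν

variable {n : ℕ}

/-- The energy distance as a weighted `L²` distance of characteristic functions. -/
theorem measureEnergy_eq_fourier (hn : 2 ≤ n) {α : ℝ} (hα0 : 0 < α) (hα2 : α < 2)
    {μ ν : Measure (EuclideanSpace ℝ (Fin n))} [IsProbabilityMeasure μ] [IsProbabilityMeasure ν]
    (hμ : Integrable (fun x => ‖x‖ ^ α) μ) (hν : Integrable (fun x => ‖x‖ ^ α) ν) :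
    Integrable (fun ξ => ‖charFun μ ξ - charFun ν ξ‖ ^ 2 * ‖ξ‖ ^ (-(n + α))) ∧
    measureEnergy α μ ν =
      cConst n α * ∫ ξ, ‖charFun μ ξ - charFun ν ξ‖ ^ 2 * ‖ξ‖ ^ (-(n + α)) := by
  have : Nonempty (Fin n) := ⟨⟨0, by omega⟩⟩
  have hI : ∀ {μ ν : Measure (EuclideanSpace ℝ (Fin n))} [IsProbabilityMeasure μ]
      [IsProbabilityMeasure ν], Integrable (fun x => ‖x‖ ^ α) μ →
      Integrable (fun x => ‖x‖ ^ α) ν →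
      IntegrableOn (fun τ : ℝ => τ ^ (-(α / 2) - 1) * (1 - gaussInteraction τ μ ν)) (Set.Ioi 0) ∧
      ∫ τ in Set.Ioi (0 : ℝ), τ ^ (-(α / 2) - 1) * (1 - gaussInteraction τ μ ν) =
        Real.Gamma (1 - α / 2) / (α / 2) * measureInteraction α μ ν := by
    intro μ ν _ _ h1 h2
    have h2a : 2 * (α / 2) = α := by ring
    have := powerInteraction_eq (μ := μ) (ν := ν) (a := α / 2) (by linarith) (by linarith)
      (by rw [h2a]; exact integrable_norm_sub_rpow hα0.le hα2.le h1 h2)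
    rwa [h2a] at this
  obtain ⟨i1, e1⟩ := hI hμ hν
  obtain ⟨i2, e2⟩ := hI hμ hμ
  obtain ⟨i3, e3⟩ := hI hν hν
  have hQ : (fun τ : ℝ => τ ^ (-(α / 2) - 1) * gaussEnergy τ μ ν) = fun τ =>
      2 * (τ ^ (-(α / 2) - 1) * (1 - gaussInteraction τ μ ν)) -
      τ ^ (-(α / 2) - 1) * (1 - gaussInteraction τ μ μ) -
      τ ^ (-(α / 2) - 1) * (1 - gaussInteraction τ ν ν) := by
    funext τ
    rw [gaussEnergy]
    ring
  have hQi : IntegrableOn (fun τ : ℝ => τ ^ (-(α / 2) - 1) * gaussEnergy τ μ ν) (Set.Ioi 0) := by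
    rw [hQ]
    exact ((i1.const_mul 2).sub i2).sub i3
  have hQe : ∫ τ in Set.Ioi (0 : ℝ), τ ^ (-(α / 2) - 1) * gaussEnergy τ μ ν =
      Real.Gamma (1 - α / 2) / (α / 2) * measureEnergy α μ ν := by
    rw [hQ]
    refine (integral_sub ((i1.const_mul 2).sub i2) i3).trans ?_
    refine (congrArg (· - _) (integral_sub (i1.const_mul 2) i2)).trans ?_
    rw [integral_const_mul, e1, e2, e3, measureEnergy]
    ring
  obtain ⟨hi, he⟩ := integral_gaussEnergy_eq (μ := μ) (ν := ν) (a := α / 2) (by positivity) hQi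
  rw [hQe] at he
  simp only [finrank_euclideanSpace, Fintype.card_fin] at he hi
  rw [show 2 * (α / 2) + (n : ℝ) = n + α by ring] at he hi
  refine ⟨hi, ?_⟩
  have hΓ : 0 < Real.Gamma (1 - α / 2) := Real.Gamma_pos_of_pos (by linarith)
  have hc : cConst n α = (Real.Gamma (1 - α / 2) / (α / 2))⁻¹ * ((4 * Real.pi) ^ (-((n : ℝ) / 2)) *
        (Real.Gamma (α / 2 + (n : ℝ) / 2) * 4 ^ (α / 2 + (n : ℝ) / 2))) := by
    rw [cConst, show ((n : ℝ) + α) / 2 = α / 2 + n / 2 by ring,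
      show (2 - α) / 2 = 1 - α / 2 by ring, Real.mul_rpow (by norm_num) Real.pi_pos.le,
      Real.rpow_add (by norm_num : (0 : ℝ) < 4), Real.rpow_neg (by norm_num : (0 : ℝ) ≤ 4),
      Real.rpow_neg Real.pi_pos.le, show (4 : ℝ) ^ (α / 2) = 2 ^ α by
        rw [show (4 : ℝ) = 2 ^ (2 : ℝ) by norm_num, ← Real.rpow_mul (by norm_num)]
        congr 1
        ring]
    have h4 : (4 : ℝ) ^ ((n : ℝ) / 2) ≠ 0 := by positivity
    field_simp
  rw [hc, mul_assoc, ← he, inv_mul_cancel_left₀ (by positivity)]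

/-- The Riesz energy as a weighted `L²` distance of characteristic functions. -/
theorem measureNegEnergy_eq_fourier (hn : 2 ≤ n) {α : ℝ} (hα0 : 0 < α) (hα2 : α < 2)
    {μ ν : Measure (EuclideanSpace ℝ (Fin n))} [IsFiniteMeasure μ] [IsFiniteMeasure ν]
    [NullSingletonClass μ] [NullSingletonClass ν]
    (h1 : Integrable (fun p => ‖p.1 - p.2‖ ^ (-(2 - α))) (μ.prod ν))
    (h2 : Integrable (fun p => ‖p.1 - p.2‖ ^ (-(2 - α))) (μ.prod μ))
    (h3 : Integrable (fun p => ‖p.1 - p.2‖ ^ (-(2 - α))) (ν.prod ν)) :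
    Integrable (fun ξ => ‖charFun μ ξ - charFun ν ξ‖ ^ 2 * ‖ξ‖ ^ (-(n - 2 + α))) ∧
    measureNegEnergy α μ ν =
      dConst n α * ∫ ξ, ‖charFun μ ξ - charFun ν ξ‖ ^ 2 * ‖ξ‖ ^ (-(n - 2 + α)) := by
  have : Nonempty (Fin n) := ⟨⟨0, by omega⟩⟩
  have hn' : (2 : ℝ) ≤ n := by exact_mod_cast hn
  have hI : ∀ {μ ν : Measure (EuclideanSpace ℝ (Fin n))} [IsFiniteMeasure μ]
      [IsFiniteMeasure ν] [NullSingletonClass ν],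
      Integrable (fun p => ‖p.1 - p.2‖ ^ (-(2 - α))) (μ.prod ν) →
      IntegrableOn (fun τ : ℝ => τ ^ (-(α / 2 - 1) - 1) * gaussInteraction τ μ ν) (Set.Ioi 0) ∧
      ∫ τ in Set.Ioi (0 : ℝ), τ ^ (-(α / 2 - 1) - 1) * gaussInteraction τ μ ν =
        Real.Gamma (1 - α / 2) * measureInteraction (-(2 - α)) μ ν := by
    intro μ ν _ _ _ h
    have h2a : -(2 * (1 - α / 2)) = -(2 - α) := by ring
    have := rieszInteraction_eq (μ := μ) (ν := ν) (b := 1 - α / 2) (by linarith)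
      (ae_prod_fst_ne_snd μ ν) (by rwa [h2a])
    rwa [h2a, show 1 - α / 2 - 1 = -(α / 2 - 1) - 1 by ring] at this
  obtain ⟨i1, e1⟩ := hI h1
  obtain ⟨i2, e2⟩ := hI h2
  obtain ⟨i3, e3⟩ := hI h3
  have hQ : (fun τ : ℝ => τ ^ (-(α / 2 - 1) - 1) * gaussEnergy τ μ ν) = fun τ =>
      τ ^ (-(α / 2 - 1) - 1) * gaussInteraction τ μ μ +
      τ ^ (-(α / 2 - 1) - 1) * gaussInteraction τ ν ν -
      2 * (τ ^ (-(α / 2 - 1) - 1) * gaussInteraction τ μ ν) := by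
    funext τ
    rw [gaussEnergy]
    ring
  have hQi : IntegrableOn (fun τ : ℝ => τ ^ (-(α / 2 - 1) - 1) * gaussEnergy τ μ ν)
      (Set.Ioi 0) := by
    rw [hQ]
    exact (i2.add i3).sub (i1.const_mul 2)
  have hQe : ∫ τ in Set.Ioi (0 : ℝ), τ ^ (-(α / 2 - 1) - 1) * gaussEnergy τ μ ν =
      Real.Gamma (1 - α / 2) * measureNegEnergy α μ ν := by
    rw [hQ]
    refine (integral_sub (i2.add i3) (i1.const_mul 2)).trans ?_
    refine (congrArg (· - _) (integral_add i2 i3)).trans ?_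
    rw [integral_const_mul, e1, e2, e3, measureNegEnergy]
    ring
  obtain ⟨hi, he⟩ := integral_gaussEnergy_eq (μ := μ) (ν := ν) (a := α / 2 - 1)
    (by simp; linarith) hQi
  rw [hQe] at he
  simp only [finrank_euclideanSpace, Fintype.card_fin] at he hi
  rw [show 2 * (α / 2 - 1) + (n : ℝ) = n - 2 + α by ring] at he hi
  refine ⟨hi, ?_⟩
  have hΓ : 0 < Real.Gamma (1 - α / 2) := Real.Gamma_pos_of_pos (by linarith)
  have hc : dConst n α = (Real.Gamma (1 - α / 2))⁻¹ * ((4 * Real.pi) ^ (-((n : ℝ) / 2)) *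
        (Real.Gamma (α / 2 - 1 + (n : ℝ) / 2) * 4 ^ (α / 2 - 1 + (n : ℝ) / 2))) := by
    rw [dConst, show ((n : ℝ) - 2 + α) / 2 = α / 2 - 1 + n / 2 by ring,
      show (2 - α) / 2 = 1 - α / 2 by ring, Real.mul_rpow (by norm_num) Real.pi_pos.le,
      Real.rpow_add (by norm_num : (0 : ℝ) < 4), Real.rpow_neg (by norm_num : (0 : ℝ) ≤ 4),
      Real.rpow_neg Real.pi_pos.le, show (4 : ℝ) ^ (α / 2 - 1) = 2 ^ α / 4 by
        rw [Real.rpow_sub_one (by norm_num)]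
        congr 1
        rw [show (4 : ℝ) = 2 ^ (2 : ℝ) by norm_num, ← Real.rpow_mul (by norm_num)]
        congr 1
        ring]
    have h4 : (4 : ℝ) ^ ((n : ℝ) / 2) ≠ 0 := by positivity
    field_simp
    ring
  rw [hc, mul_assoc, ← he, inv_mul_cancel_left₀ (by positivity)]

theorem cConst_pos (hn : 2 ≤ n) {α : ℝ} (hα0 : 0 < α) (hα2 : α < 2) : 0 < cConst n α := by
  have hn' : (2 : ℝ) ≤ n := by exact_mod_cast hn
  have h1 : 0 < Real.Gamma ((n + α) / 2) := Real.Gamma_pos_of_pos (by linarith)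
  have h2 : 0 < Real.Gamma ((2 - α) / 2) := Real.Gamma_pos_of_pos (by linarith)
  unfold cConst
  positivity

theorem dConst_pos (hn : 2 ≤ n) {α : ℝ} (hα0 : 0 < α) (hα2 : α < 2) : 0 < dConst n α := by
  have hn' : (2 : ℝ) ≤ n := by exact_mod_cast hn
  have h1 : 0 < Real.Gamma ((n - 2 + α) / 2) := Real.Gamma_pos_of_pos (by linarith)
  have h2 : 0 < Real.Gamma ((2 - α) / 2) := Real.Gamma_pos_of_pos (by linarith)
  unfold dConst
  positivity

/-- The ratio of the two Fourier constants, by `Γ(z+1) = zΓ(z)`. -/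
theorem cConst_eq_mul_dConst (hn : 2 ≤ n) {α : ℝ} (hα0 : 0 < α) (hα2 : α < 2) :
    cConst n α = α * (n - 2 + α) * dConst n α := by
  have hn' : (2 : ℝ) ≤ n := by exact_mod_cast hn
  have h2 : 0 < Real.Gamma ((2 - α) / 2) := Real.Gamma_pos_of_pos (by linarith)
  rw [cConst, dConst, show ((n : ℝ) + α) / 2 = (n - 2 + α) / 2 + 1 by ring,
    Real.Gamma_add_one (by linarith)]
  field_simp

/-! ### The differential inequality and its ingredients -/

/-- Comparison for the differential inequality `u' ≤ -C u^{1+q}`. -/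
theorem le_of_hasDerivAt_le_neg_rpow {u u' : ℝ → ℝ} {C q u₀ : ℝ} (hC : 0 ≤ C) (hq : 0 < q)
    (hu : ∀ t, 0 < t → 0 ≤ u t) (hu₀ : ∀ t, 0 < t → u t ≤ u₀)
    (hd : ∀ t, 0 < t → HasDerivAt u (u' t) t) (hle : ∀ t, 0 < t → u' t ≤ -C * u t ^ (1 + q))
    {t : ℝ} (ht : 0 < t) : u t ≤ (u₀ ^ (-q) + C * q * t) ^ (-q⁻¹) := by
  have hu₀0 : 0 ≤ u₀ := (hu t ht).trans (hu₀ t ht)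
  have hbase : 0 ≤ u₀ ^ (-q) + C * q * t := by positivity
  rcases (hu t ht).eq_or_lt with h0 | hpos
  · rw [← h0]
    exact Real.rpow_nonneg hbase _
  have hu₀pos : 0 < u₀ := hpos.trans_le (hu₀ t ht)
  have hanti : AntitoneOn u (Set.Ioi 0) := by
    refine antitoneOn_of_hasDerivWithinAt_nonpos (convex_Ioi 0)
      (fun s hs => (hd s hs).continuousAt.continuousWithinAt)
      (fun s hs => (hd s (interior_subset hs)).hasDerivWithinAt) fun s hs => ?_
    have hs0 : 0 < s := interior_subset hs
    have := mul_nonneg hC (Real.rpow_nonneg (hu s hs0) (1 + q))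
    linarith [hle s hs0]
  -- `s ↦ u(s)^{-q} - C q s` is nondecreasing on `[ε, t]`, and `u ε ≤ u₀`
  have hstep : ∀ ε, 0 < ε → ε ≤ t → u₀ ^ (-q) + C * q * (t - ε) ≤ u t ^ (-q) := by
    intro ε hε hεt
    have hpos' : ∀ s ∈ Set.Icc ε t, 0 < u s := fun s hs =>
      hpos.trans_le (hanti (hε.trans_le hs.1) ht hs.2)
    have hd' : ∀ s ∈ Set.Icc ε t, HasDerivAt (fun s => u s ^ (-q) - C * q * s)
        (u' s * (-q) * u s ^ (-q - 1) - C * q * 1) s := fun s hs =>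
      ((hd s (hε.trans_le hs.1)).rpow_const (Or.inl (hpos' s hs).ne')).sub
        ((hasDerivAt_id s).const_mul _)
    have hmono : MonotoneOn (fun s => u s ^ (-q) - C * q * s) (Set.Icc ε t) := by
      refine monotoneOn_of_hasDerivWithinAt_nonneg (convex_Icc ε t)
        (fun s hs => (hd' s hs).continuousAt.continuousWithinAt)
        (fun s hs => (hd' s (interior_subset hs)).hasDerivWithinAt) fun s hs => ?_
      have hs' := interior_subset hs
      have hp := hpos' s hs'
      have h1 : u s ^ (1 + q) * u s ^ (-q - 1) = 1 := by
        rw [← Real.rpow_add hp, show 1 + q + (-q - 1) = 0 by ring, Real.rpow_zero]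
      have h2 := mul_le_mul_of_nonneg_right (hle s (hε.trans_le hs'.1))
        (mul_nonneg hq.le (Real.rpow_nonneg hp.le (-q - 1)))
      have h3 : -C * u s ^ (1 + q) * (q * u s ^ (-q - 1)) = -(C * q) := by
        rw [show -C * u s ^ (1 + q) * (q * u s ^ (-q - 1)) =
          -(C * q) * (u s ^ (1 + q) * u s ^ (-q - 1)) by ring, h1, mul_one]
      rw [h3] at h2
      linarith
    have h4 := hmono (Set.left_mem_Icc.2 hεt) (Set.right_mem_Icc.2 hεt) hεt
    have h5 : u₀ ^ (-q) ≤ u ε ^ (-q) :=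
      Real.rpow_le_rpow_of_nonpos (hpos' ε (Set.left_mem_Icc.2 hεt)) (hu₀ ε hε) (by linarith)
    linarith
  have hlim : u₀ ^ (-q) + C * q * t ≤ u t ^ (-q) := by
    have h1 : Tendsto (fun ε => u₀ ^ (-q) + C * q * (t - ε)) (𝓝[>] 0)
        (𝓝 (u₀ ^ (-q) + C * q * (t - 0))) :=
      ((by fun_prop : Continuous fun ε => u₀ ^ (-q) + C * q * (t - ε)).tendsto 0).mono_left
        nhdsWithin_le_nhds
    rw [sub_zero] at h1
    refine le_of_tendsto h1 ?_
    filter_upwards [Ioc_mem_nhdsGT ht] with ε hε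
    exact hstep ε hε.1 hε.2
  have hb : 0 < u₀ ^ (-q) + C * q * t := by positivity
  have h6 := Real.rpow_le_rpow_of_nonpos hb hlim (by
    have := inv_pos.2 hq
    linarith : -q⁻¹ ≤ 0)
  rwa [← Real.rpow_mul hpos.le, neg_mul_neg, mul_inv_cancel₀ hq.ne', Real.rpow_one] at h6

/-- The integral of `|x|^{-q}` over the ball of radius `R`, for `q < n`; the factor is the area
of the unit sphere. -/
theorem integral_ball_rpow (hn : 2 ≤ n) {q R : ℝ} (hq : q < n) (hR : 0 < R) :
    Integrable (fun x : EuclideanSpace ℝ (Fin n) =>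
      (Set.Iio R).indicator (fun r : ℝ => r ^ (-q)) ‖x‖) ∧
    ∫ x : EuclideanSpace ℝ (Fin n), (Set.Iio R).indicator (fun r : ℝ => r ^ (-q)) ‖x‖ =
      2 * Real.pi ^ ((n : ℝ) / 2) / Real.Gamma ((n : ℝ) / 2) * (R ^ (n - q) / (n - q)) := by
  have : Nonempty (Fin n) := ⟨⟨0, by omega⟩⟩
  have hn1 : ((n - 1 : ℕ) : ℝ) = n - 1 := by
    rw [Nat.cast_sub (by omega)]
    simp
  have hfun : ∀ y ∈ Set.Ioi (0 : ℝ),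
      y ^ (n - 1) • (Set.Iio R).indicator (fun r : ℝ => r ^ (-q)) y =
        (Set.Iio R).indicator (fun r : ℝ => r ^ (n - q - 1)) y := by
    intro y hy
    have hy0 : (0 : ℝ) < y := hy
    by_cases h : y ∈ Set.Iio R
    · rw [Set.indicator_of_mem h, Set.indicator_of_mem h, smul_eq_mul, ← Real.rpow_natCast, hn1,
        ← Real.rpow_add hy0]
      congr 1
      ring
    · simp [Set.indicator_of_notMem h]
  have hset : Set.Ioi (0 : ℝ) ∩ Set.Iio R = Set.Ioo 0 R := rfl
  have hint : IntegrableOn (fun r : ℝ => r ^ (n - q - 1)) (Set.Ioo 0 R) := by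
    have := intervalIntegral.intervalIntegrable_rpow' (a := 0) (b := R) (r := n - q - 1)
      (by linarith)
    rwa [intervalIntegrable_iff_integrableOn_Ioo_of_le hR.le] at this
  constructor
  · rw [integrable_fun_norm_addHaar (volume : Measure (EuclideanSpace ℝ (Fin n)))
      (f := (Set.Iio R).indicator (fun r : ℝ => r ^ (-q)))]
    simp only [finrank_euclideanSpace, Fintype.card_fin]
    rw [integrableOn_congr_fun hfun measurableSet_Ioi, IntegrableOn,
      integrable_indicator_iff measurableSet_Iio, IntegrableOn,
      Measure.restrict_restrict measurableSet_Iio, Set.inter_comm, hset]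
    exact hint
  · rw [integral_fun_norm_addHaar (volume : Measure (EuclideanSpace ℝ (Fin n)))
      ((Set.Iio R).indicator (fun r : ℝ => r ^ (-q)))]
    simp only [finrank_euclideanSpace, Fintype.card_fin]
    rw [setIntegral_congr_fun measurableSet_Ioi hfun, setIntegral_indicator measurableSet_Iio, hset,
      ← integral_Ioc_eq_integral_Ioo, ← intervalIntegral.integral_of_le hR.le,
      integral_rpow (Or.inl (by linarith)), sub_add_cancel,
      Real.zero_rpow (by linarith : (0 : ℝ) < n - q).ne', sub_zero, measureReal_def,
      EuclideanSpace.volume_ball]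
    have hn0 : (0 : ℝ) < (n : ℝ) / 2 := by
      have : (2 : ℝ) ≤ n := by exact_mod_cast hn
      linarith
    have hΓ : 0 < Real.Gamma ((n : ℝ) / 2) := Real.Gamma_pos_of_pos hn0
    have hpi : √Real.pi ^ n = Real.pi ^ ((n : ℝ) / 2) := by
      rw [Real.sqrt_eq_rpow, ← Real.rpow_natCast, ← Real.rpow_mul Real.pi_pos.le]
      congr 1
      ring
    simp only [ENNReal.ofReal_one, one_pow, one_mul, Fintype.card_fin]
    rw [ENNReal.toReal_ofReal (by rw [Real.Gamma_add_one hn0.ne']; positivity),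
      Real.Gamma_add_one hn0.ne', hpi, nsmul_eq_mul, smul_eq_mul]
    have : (n : ℝ) ≠ 0 := by linarith
    have : (n : ℝ) - q ≠ 0 := by linarith
    field_simp

/-- Splitting the Fourier integral at `|ξ| = R`. -/
theorem integral_split_le (hn : 2 ≤ n) {α d R : ℝ} (hα0 : 0 < α) (hα2 : α < 2) (hR : 0 < R)
    {w : EuclideanSpace ℝ (Fin n) → ℝ} (hw0 : ∀ ξ, 0 ≤ w ξ) (hwd : ∀ ξ, w ξ ≤ d ^ 2 * ‖ξ‖ ^ 2)
    (h1 : Integrable fun ξ => w ξ * ‖ξ‖ ^ (-(n + α)))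
    (h2 : Integrable fun ξ => w ξ * ‖ξ‖ ^ (-(n - 2 + α))) :
    ∫ ξ, w ξ * ‖ξ‖ ^ (-(n + α)) ≤
      2 * Real.pi ^ ((n : ℝ) / 2) / Real.Gamma ((n : ℝ) / 2) * d ^ 2 * (R ^ (2 - α) / (2 - α)) +
        (R ^ 2)⁻¹ * ∫ ξ, w ξ * ‖ξ‖ ^ (-(n - 2 + α)) := by
  obtain ⟨hi, he⟩ := integral_ball_rpow hn (q := n - 2 + α) (by linarith) hR
  rw [show (n : ℝ) - (n - 2 + α) = 2 - α by ring] at he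
  calc _ ≤ ∫ ξ, (d ^ 2 * (Set.Iio R).indicator (fun r : ℝ => r ^ (-(n - 2 + α))) ‖ξ‖ +
        (R ^ 2)⁻¹ * (w ξ * ‖ξ‖ ^ (-(n - 2 + α)))) := by
        refine integral_mono h1 ((hi.const_mul _).add (h2.const_mul _)) fun ξ => ?_
        have hn' : (2 : ℝ) ≤ n := by exact_mod_cast hn
        rcases eq_or_ne ξ 0 with rfl | hξ
        -- at the origin all the negative powers are zero by convention
        · simp only [norm_zero]
          rw [Real.zero_rpow (by linarith : (-((n : ℝ) + α)) ≠ 0),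
            Real.zero_rpow (by linarith : (-((n : ℝ) - 2 + α)) ≠ 0),
            Set.indicator_of_mem (Set.mem_Iio.2 hR),
            Real.zero_rpow (by linarith : (-((n : ℝ) - 2 + α)) ≠ 0)]
          simp
        have hξ0 : 0 < ‖ξ‖ := norm_pos_iff.2 hξ
        have hpow : ‖ξ‖ ^ 2 * ‖ξ‖ ^ (-(n + α)) = ‖ξ‖ ^ (-(n - 2 + α)) := by
          rw [← Real.rpow_natCast, ← Real.rpow_add hξ0]
          congr 1
          push_cast
          ring
        by_cases h : ‖ξ‖ ∈ Set.Iio R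
        · rw [Set.indicator_of_mem h, ← hpow]
          have a1 : w ξ * ‖ξ‖ ^ (-(n + α)) ≤ d ^ 2 * ‖ξ‖ ^ 2 * ‖ξ‖ ^ (-(n + α)) :=
            mul_le_mul_of_nonneg_right (hwd ξ) (by positivity)
          have a2 : 0 ≤ (R ^ 2)⁻¹ * (w ξ * (‖ξ‖ ^ 2 * ‖ξ‖ ^ (-(n + α)))) :=
            mul_nonneg (by positivity) (mul_nonneg (hw0 ξ) (by positivity))
          linarith
        · rw [Set.indicator_of_notMem h, ← hpow, mul_zero, zero_add]
          have hRξ : R ≤ ‖ξ‖ := not_lt.1 h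
          have a1 : 1 ≤ (R ^ 2)⁻¹ * ‖ξ‖ ^ 2 := by
            rw [inv_mul_eq_div, one_le_div (by positivity)]
            gcongr
          have a2 : 0 ≤ w ξ * ‖ξ‖ ^ (-(n + α)) := mul_nonneg (hw0 ξ) (by positivity)
          calc _ = 1 * (w ξ * ‖ξ‖ ^ (-(n + α))) := (one_mul _).symm
            _ ≤ (R ^ 2)⁻¹ * ‖ξ‖ ^ 2 * (w ξ * ‖ξ‖ ^ (-(n + α))) :=
              mul_le_mul_of_nonneg_right a1 a2
            _ = _ := by ring
    _ = _ := by
        rw [integral_add (hi.const_mul _) (h2.const_mul _), integral_const_mul,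
          integral_const_mul, he]
        ring

/-- The value at the optimal radius `R^{4-α} = 2Be/(Ad²)` of the bound obtained by splitting. -/
theorem split_bound_optimal {α A B d e : ℝ} (hα2 : α < 2) (hA : 0 < A) (hB : 0 < B) (hd : 0 < d)
    (he : 0 < e) :
    ∃ R : ℝ, 0 < R ∧ A * d ^ 2 * (R ^ (2 - α) / (2 - α)) + (R ^ 2)⁻¹ * (B * e) =
      A ^ (2 / (4 - α)) * B ^ ((2 - α) / (4 - α)) *
        (2 ^ ((2 - α) / (4 - α)) / (2 - α) + (1 / 2) ^ (2 / (4 - α))) * d ^ (4 / (4 - α)) *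
          e ^ ((2 - α) / (4 - α)) := by
  refine ⟨(2 * B * e / (A * d ^ 2)) ^ (4 - α)⁻¹, by positivity, ?_⟩
  -- in logarithmic variables, comparing the powers is linear arithmetic in the exponents
  obtain ⟨a, rfl⟩ : ∃ a, A = Real.exp a := ⟨_, (Real.exp_log hA).symm⟩
  obtain ⟨b, rfl⟩ : ∃ a, B = Real.exp a := ⟨_, (Real.exp_log hB).symm⟩
  obtain ⟨x, rfl⟩ : ∃ a, d = Real.exp a := ⟨_, (Real.exp_log hd).symm⟩
  obtain ⟨y, rfl⟩ : ∃ a, e = Real.exp a := ⟨_, (Real.exp_log he).symm⟩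
  obtain ⟨l, hl⟩ : ∃ a, (2 : ℝ) = Real.exp a := ⟨_, (Real.exp_log two_pos).symm⟩
  have h4 : (4 - α) ≠ 0 := by linarith
  have hY : 2 * Real.exp b * Real.exp y / (Real.exp a * Real.exp x ^ 2) =
      Real.exp (l + b + y - a - 2 * x) := by
    rw [show l + b + y - a - 2 * x = l + b + y - (a + 2 * x) by ring, Real.exp_sub, Real.exp_add,
      Real.exp_add, Real.exp_add, ← hl, two_mul x, Real.exp_add, sq]
  have hx2 : Real.exp x ^ 2 = Real.exp (2 * x) := by
    rw [two_mul, Real.exp_add, sq]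
  have e1 : Real.exp a * Real.exp x ^ 2 *
      (Real.exp (l + b + y - a - 2 * x) ^ (4 - α)⁻¹) ^ (2 - α) =
      Real.exp a ^ (2 / (4 - α)) * Real.exp b ^ ((2 - α) / (4 - α)) *
        Real.exp l ^ ((2 - α) / (4 - α)) * Real.exp x ^ (4 / (4 - α)) *
          Real.exp y ^ ((2 - α) / (4 - α)) := by
    rw [hx2]
    simp only [← Real.exp_mul, ← Real.exp_add]
    congr 1
    field_simp
    ring
  have e2 : ((Real.exp (l + b + y - a - 2 * x) ^ (4 - α)⁻¹) ^ 2)⁻¹ *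
      (Real.exp b * Real.exp y) =
      Real.exp a ^ (2 / (4 - α)) * Real.exp b ^ ((2 - α) / (4 - α)) *
        Real.exp (-l) ^ (2 / (4 - α)) * Real.exp x ^ (4 / (4 - α)) *
          Real.exp y ^ ((2 - α) / (4 - α)) := by
    rw [← Real.rpow_natCast (Real.exp (l + b + y - a - 2 * x) ^ (4 - α)⁻¹) 2]
    simp only [← Real.exp_mul, ← Real.exp_neg, ← Real.exp_add]
    congr 1
    push_cast
    field_simp
    ring
  have hl2 : (1 / 2 : ℝ) = Real.exp (-l) := by rw [Real.exp_neg, ← hl, one_div]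
  rw [← hl] at e1
  rw [hY, e2, hl2, ← mul_div_assoc, e1]
  ring

theorem AConst_pos (hn : 2 ≤ n) {α : ℝ} (hα0 : 0 < α) (hα2 : α < 2) : 0 < AConst n α := by
  have hn' : (2 : ℝ) ≤ n := by exact_mod_cast hn
  have h1 : 0 < Real.Gamma ((n : ℝ) / 2) := Real.Gamma_pos_of_pos (by linarith)
  have := cConst_pos hn hα0 hα2
  unfold AConst
  positivity

theorem BConst_pos (hn : 2 ≤ n) {α : ℝ} (hα0 : 0 < α) (hα2 : α < 2) : 0 < BConst n α :=
  div_pos (cConst_pos hn hα0 hα2) (dConst_pos hn hα0 hα2)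

theorem DConst_pos (hn : 2 ≤ n) {α : ℝ} (hα0 : 0 < α) (hα2 : α < 2) : 0 < DConst n α := by
  have h1 := AConst_pos hn hα0 hα2
  have h2 := BConst_pos hn hα0 hα2
  have h3 : 0 < 2 - α := by linarith
  unfold DConst
  positivity

theorem decayConst_pos (hn : 2 ≤ n) {α d : ℝ} (hα0 : 0 < α) (hα2 : α < 2) (hd : 0 < d) :
    0 < decayConst n α d := by
  have hn' : (2 : ℝ) ≤ n := by exact_mod_cast hn
  have h1 := DConst_pos hn hα0 hα2
  have h3 : 0 < (n : ℝ) - 2 + α := by linarith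
  unfold decayConst
  positivity

/-- The convention at `d = 0`: a negative power of zero is zero. -/
theorem decayConst_zero {α : ℝ} (hα2 : α < 2) : decayConst n α 0 = 0 := by
  have h2 : (4 : ℝ) - α ≠ 0 := by linarith
  have h3 : (2 : ℝ) - α ≠ 0 := by linarith
  rw [decayConst, Real.zero_rpow (div_ne_zero (by norm_num) h2), mul_zero,
    Real.zero_rpow (neg_ne_zero.2 (div_ne_zero h2 h3)), mul_zero]

/-- The interpolation inequality, in Fourier variables: the energy of order `α` is controlled by
the energy of order `-(2-α)` and the bound `w(ξ) ≤ d²|ξ|²`. -/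
theorem decayConst_mul_rpow_le (hn : 2 ≤ n) {α d : ℝ} (hα0 : 0 < α) (hα2 : α < 2) (hd : 0 ≤ d)
    {w : EuclideanSpace ℝ (Fin n) → ℝ} (hw0 : ∀ ξ, 0 ≤ w ξ) (hwd : ∀ ξ, w ξ ≤ d ^ 2 * ‖ξ‖ ^ 2)
    (h1 : Integrable fun ξ => w ξ * ‖ξ‖ ^ (-(n + α)))
    (h2 : Integrable fun ξ => w ξ * ‖ξ‖ ^ (-(n - 2 + α))) :
    decayConst n α d * (cConst n α * ∫ ξ, w ξ * ‖ξ‖ ^ (-(n + α))) ^ ((4 - α) / (2 - α)) ≤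
      2 * α * (n - 2 + α) * (dConst n α * ∫ ξ, w ξ * ‖ξ‖ ^ (-(n - 2 + α))) := by
  have hn' : (2 : ℝ) ≤ n := by exact_mod_cast hn
  have hc := cConst_pos hn hα0 hα2
  have hdc := dConst_pos hn hα0 hα2
  have hD := DConst_pos hn hα0 hα2
  have hK : 0 < 2 * α * (n - 2 + α) := by
    have : 0 < (n : ℝ) - 2 + α := by linarith
    positivity
  set J := ∫ ξ, w ξ * ‖ξ‖ ^ (-(n + α)) with hJ
  set I := ∫ ξ, w ξ * ‖ξ‖ ^ (-(n - 2 + α)) with hI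
  have hJ0 : 0 ≤ J := integral_nonneg fun ξ => mul_nonneg (hw0 ξ) (by positivity)
  have hI0 : 0 ≤ I := integral_nonneg fun ξ => mul_nonneg (hw0 ξ) (by positivity)
  rcases hd.eq_or_lt with rfl | hd
  · rw [decayConst_zero hα2, zero_mul]
    positivity
  set X := DConst n α * d ^ (4 / (4 - α)) with hX
  have hX0 : 0 < X := by positivity
  have h4 : 0 < 4 - α := by linarith
  have h2α : 0 < 2 - α := by linarith
  -- `E_{-(2-α)}` may vanish, so the optimal radius is taken for an arbitrary `e` above it
  have key : ∀ e, dConst n α * I < e → (X⁻¹ * (cConst n α * J)) ^ ((4 - α) / (2 - α)) ≤ e := by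
    intro e he
    have he0 : 0 < e := lt_of_le_of_lt (by positivity) he
    obtain ⟨R, hR, hRe⟩ := split_bound_optimal hα2 (AConst_pos hn hα0 hα2)
      (BConst_pos hn hα0 hα2) hd he0
    have hs := mul_le_mul_of_nonneg_left (integral_split_le hn hα0 hα2 hR hw0 hwd h1 h2) hc.le
    have hcI : cConst n α * I ≤ BConst n α * e := by
      have : cConst n α * I = BConst n α * (dConst n α * I) := by
        rw [BConst]
        field_simp
      rw [this]
      exact mul_le_mul_of_nonneg_left he.le (BConst_pos hn hα0 hα2).le
    have hle : cConst n α * J ≤ X * e ^ ((2 - α) / (4 - α)) := by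
      have hE : X * e ^ ((2 - α) / (4 - α)) = AConst n α * d ^ 2 * (R ^ (2 - α) / (2 - α)) +
          (R ^ 2)⁻¹ * (BConst n α * e) := by
        rw [hRe, hX, DConst]
      rw [hE]
      refine hs.trans ?_
      have hm := mul_le_mul_of_nonneg_left hcI (inv_nonneg.2 (sq_nonneg R))
      rw [AConst]
      linarith
    have hle2 : X⁻¹ * (cConst n α * J) ≤ e ^ ((2 - α) / (4 - α)) := by
      rw [inv_mul_le_iff₀ hX0]
      exact hle
    refine (Real.rpow_le_rpow (by positivity) hle2 (by positivity)).trans_eq ?_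
    rw [← Real.rpow_mul he0.le, div_mul_div_cancel₀ h4.ne', div_self h2α.ne', Real.rpow_one]
  have hfin := le_of_forall_gt_imp_ge_of_dense key
  rw [Real.mul_rpow (by positivity) (by positivity), Real.inv_rpow hX0.le,
    ← Real.rpow_neg hX0.le] at hfin
  rw [decayConst, ← hX, mul_assoc]
  exact mul_le_mul_of_nonneg_left hfin hK.le

/-- Differentiation of the Fourier energy along the heat flow. The derivative is dominated by
`(2/t) w(ξ) |ξ|^{-(n+α)}` near time `t`. -/
theorem hasDerivAt_integral_heat (hn : 2 ≤ n) {α : ℝ} (hα0 : 0 < α)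
    {w : EuclideanSpace ℝ (Fin n) → ℝ} (hw0 : ∀ ξ, 0 ≤ w ξ)
    (h1 : Integrable fun ξ => w ξ * ‖ξ‖ ^ (-(n + α))) {t : ℝ} (ht : 0 < t) :
    HasDerivAt (fun s => ∫ ξ, Real.exp (-(2 * s * ‖ξ‖ ^ 2)) * w ξ * ‖ξ‖ ^ (-(n + α)))
        (-2 * ∫ ξ, Real.exp (-(2 * t * ‖ξ‖ ^ 2)) * w ξ * ‖ξ‖ ^ (-(n - 2 + α))) t := by
  have hn' : (2 : ℝ) ≤ n := by exact_mod_cast hn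
  have hpow : ∀ ξ : EuclideanSpace ℝ (Fin n),
      ‖ξ‖ ^ (-(n - 2 + α)) = ‖ξ‖ ^ 2 * ‖ξ‖ ^ (-(n + α)) := by
    intro ξ
    rcases eq_or_ne ξ 0 with rfl | hξ
    -- at the origin the negative power is zero by convention
    · rw [norm_zero, Real.zero_rpow (by linarith)]
      simp
    have hξ0 : 0 < ‖ξ‖ := norm_pos_iff.2 hξ
    rw [← Real.rpow_natCast, ← Real.rpow_add hξ0]
    congr 1
    push_cast
    ring
  have hexp : ∀ (s : ℝ), AEStronglyMeasurable
      (fun ξ : EuclideanSpace ℝ (Fin n) => Real.exp (-(2 * s * ‖ξ‖ ^ 2))) volume := fun s =>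
    Continuous.aestronglyMeasurable (by fun_prop)
  have hmeas : ∀ s : ℝ, AEStronglyMeasurable (fun ξ : EuclideanSpace ℝ (Fin n) =>
      Real.exp (-(2 * s * ‖ξ‖ ^ 2)) * w ξ * ‖ξ‖ ^ (-(n + α))) volume := by
    intro s
    refine ((hexp s).mul h1.aestronglyMeasurable).congr (Eventually.of_forall fun ξ => ?_)
    exact (mul_assoc _ _ _).symm
  have key := (hasDerivAt_integral_of_dominated_loc_of_deriv_le (μ := volume) (x₀ := t)
    (s := Set.Ioi (t / 2))
    (F := fun s (ξ : EuclideanSpace ℝ (Fin n)) =>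
      Real.exp (-(2 * s * ‖ξ‖ ^ 2)) * w ξ * ‖ξ‖ ^ (-(n + α)))
    (F' := fun s ξ => -2 * (Real.exp (-(2 * s * ‖ξ‖ ^ 2)) * w ξ * ‖ξ‖ ^ (-(n - 2 + α))))
    (bound := fun ξ => 2 / t * (w ξ * ‖ξ‖ ^ (-(n + α))))
    (Ioi_mem_nhds (by linarith)) (Eventually.of_forall hmeas) ?_ ?_ ?_ (h1.const_mul _) ?_).2
  · rwa [integral_const_mul] at key
  · refine h1.mono' (hmeas t) (Eventually.of_forall fun ξ => ?_)
    have h0 : 0 ≤ w ξ * ‖ξ‖ ^ (-(n + α)) := mul_nonneg (hw0 ξ) (by positivity)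
    rw [mul_assoc, norm_mul, Real.norm_of_nonneg (Real.exp_pos _).le, Real.norm_of_nonneg h0]
    refine mul_le_of_le_one_left h0 (Real.exp_le_one_iff.2 ?_)
    have : 0 ≤ 2 * t * ‖ξ‖ ^ 2 := by positivity
    linarith
  · simp only [hpow]
    have : (fun ξ : EuclideanSpace ℝ (Fin n) => -2 * (Real.exp (-(2 * t * ‖ξ‖ ^ 2)) * w ξ *
        (‖ξ‖ ^ 2 * ‖ξ‖ ^ (-(n + α))))) = fun ξ => (-2 * ‖ξ‖ ^ 2) *
        (Real.exp (-(2 * t * ‖ξ‖ ^ 2)) * w ξ * ‖ξ‖ ^ (-(n + α))) := by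
      funext ξ
      ring
    rw [this]
    exact (Continuous.aestronglyMeasurable (by fun_prop)).mul (hmeas t)
  · refine Eventually.of_forall fun ξ s hs => ?_
    have h0 : 0 ≤ w ξ * ‖ξ‖ ^ (-(n + α)) := mul_nonneg (hw0 ξ) (by positivity)
    have hs' : t / 2 < s := hs
    have a1 : Real.exp (-(2 * s * ‖ξ‖ ^ 2)) ≤ Real.exp (-(t * ‖ξ‖ ^ 2)) := by
      refine Real.exp_le_exp.2 (neg_le_neg ?_)
      gcongr
      linarith
    have a2 : t * ‖ξ‖ ^ 2 * Real.exp (-(t * ‖ξ‖ ^ 2)) ≤ 1 := by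
      rw [Real.exp_neg, ← div_eq_mul_inv, div_le_one (Real.exp_pos _)]
      linarith [Real.add_one_le_exp (t * ‖ξ‖ ^ 2)]
    have a3 : ‖ξ‖ ^ 2 * Real.exp (-(2 * s * ‖ξ‖ ^ 2)) ≤ 1 / t := by
      rw [le_div_iff₀ ht]
      have := mul_le_mul_of_nonneg_left a1 (by positivity : 0 ≤ t * ‖ξ‖ ^ 2)
      linarith
    calc _ = 2 * ((‖ξ‖ ^ 2 * Real.exp (-(2 * s * ‖ξ‖ ^ 2))) * (w ξ * ‖ξ‖ ^ (-(n + α)))) := by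
          have := hw0 ξ
          rw [hpow, norm_mul, norm_neg, Real.norm_of_nonneg zero_le_two,
            Real.norm_of_nonneg (by positivity)]
          ring
      _ ≤ 2 * (1 / t * (w ξ * ‖ξ‖ ^ (-(n + α)))) := by gcongr
      _ = _ := by ring
  · refine Eventually.of_forall fun ξ s _ => ?_
    have h := (((((hasDerivAt_id s).const_mul 2).mul_const (‖ξ‖ ^ 2)).neg.exp).mul_const
      (w ξ)).mul_const (‖ξ‖ ^ (-(n + α)))
    refine h.congr_deriv ?_
    rw [hpow]
    simp
    ring

/-! ### Measures with a density -/

/-- The measure with density `f`; for `f` of variable sign, with density the positive part. -/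
def densityMeasure (f : EuclideanSpace ℝ (Fin n) → ℝ) : Measure (EuclideanSpace ℝ (Fin n)) :=
  volume.withDensity fun x => ENNReal.ofReal (f x)

theorem isFiniteMeasure_densityMeasure {f : EuclideanSpace ℝ (Fin n) → ℝ} (hf : Integrable f) :
    IsFiniteMeasure (densityMeasure f) :=
  isFiniteMeasure_withDensity_ofReal hf.2

theorem integral_densityMeasure {F : Type*} [NormedAddCommGroup F] [NormedSpace ℝ F]
    {f : EuclideanSpace ℝ (Fin n) → ℝ} (hf : Integrable f) (g : EuclideanSpace ℝ (Fin n) → F) :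
    ∫ x, g x ∂(densityMeasure f) = ∫ x, max (f x) 0 • g x := by
  rw [densityMeasure, integral_withDensity_eq_integral_toReal_smul₀ hf.1.aemeasurable.ennreal_ofReal
    (Eventually.of_forall fun x => ENNReal.ofReal_lt_top)]
  simp only [ENNReal.toReal_ofReal']

theorem IsProbDensity.isProbabilityMeasure {f : EuclideanSpace ℝ (Fin n) → ℝ}
    (hf : IsProbDensity f) : IsProbabilityMeasure (densityMeasure f) := by
  refine ⟨?_⟩
  rw [densityMeasure, withDensity_apply _ MeasurableSet.univ, Measure.restrict_univ,
    ← ofReal_integral_eq_lintegral_ofReal hf.2.1 hf.1, hf.2.2, ENNReal.ofReal_one]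

instance (f : EuclideanSpace ℝ (Fin n) → ℝ) : SFinite (densityMeasure f) := by
  unfold densityMeasure
  infer_instance

theorem integrable_densityMeasure_iff {f : EuclideanSpace ℝ (Fin n) → ℝ} (hf : Integrable f)
    (h0 : ∀ᵐ x, 0 ≤ f x) (g : EuclideanSpace ℝ (Fin n) → ℝ) :
    Integrable g (densityMeasure f) ↔ Integrable fun x => g x * f x := by
  rw [densityMeasure, integrable_withDensity_iff_integrable_smul₀'
    hf.1.aemeasurable.ennreal_ofReal (Eventually.of_forall fun x => ENNReal.ofReal_lt_top)]
  refine integrable_congr ?_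
  filter_upwards [h0] with x hx
  rw [ENNReal.toReal_ofReal hx, smul_eq_mul, mul_comm]

theorem densityMeasure_prod {f g : EuclideanSpace ℝ (Fin n) → ℝ} (hf : Integrable f)
    (hg : Integrable g) : (densityMeasure f).prod (densityMeasure g) =
      volume.withDensity fun p : EuclideanSpace ℝ (Fin n) × EuclideanSpace ℝ (Fin n) =>
        ENNReal.ofReal (f p.1) * ENNReal.ofReal (g p.2) :=
  prod_withDensity₀ hf.1.aemeasurable.ennreal_ofReal hg.1.aemeasurable.ennreal_ofReal

theorem aemeasurable_density_prod {f g : EuclideanSpace ℝ (Fin n) → ℝ} (hf : Integrable f)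
    (hg : Integrable g) : AEMeasurable (fun p : EuclideanSpace ℝ (Fin n) ×
      EuclideanSpace ℝ (Fin n) => ENNReal.ofReal (f p.1) * ENNReal.ofReal (g p.2)) volume :=
  (hf.1.aemeasurable.ennreal_ofReal.comp_fst).mul (hg.1.aemeasurable.ennreal_ofReal.comp_snd)

theorem ae_density_prod {f g : EuclideanSpace ℝ (Fin n) → ℝ} (hf0 : ∀ᵐ x, 0 ≤ f x)
    (hg0 : ∀ᵐ x, 0 ≤ g x) : ∀ᵐ p : EuclideanSpace ℝ (Fin n) × EuclideanSpace ℝ (Fin n),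
      (ENNReal.ofReal (f p.1) * ENNReal.ofReal (g p.2)).toReal = f p.1 * g p.2 := by
  have h1 : ∀ᵐ p : EuclideanSpace ℝ (Fin n) × EuclideanSpace ℝ (Fin n), 0 ≤ f p.1 :=
    Measure.quasiMeasurePreserving_fst.ae hf0
  have h2 : ∀ᵐ p : EuclideanSpace ℝ (Fin n) × EuclideanSpace ℝ (Fin n), 0 ≤ g p.2 :=
    Measure.quasiMeasurePreserving_snd.ae hg0
  filter_upwards [h1, h2] with p hp1 hp2
  rw [ENNReal.toReal_mul, ENNReal.toReal_ofReal hp1, ENNReal.toReal_ofReal hp2]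

theorem interactionConverges_iff {f g : EuclideanSpace ℝ (Fin n) → ℝ} (hf : Integrable f)
    (hg : Integrable g) (hf0 : ∀ᵐ x, 0 ≤ f x) (hg0 : ∀ᵐ x, 0 ≤ g x) (s : ℝ) :
    InteractionConverges s f g ↔
      Integrable (fun p : EuclideanSpace ℝ (Fin n) × EuclideanSpace ℝ (Fin n) =>
        ‖p.1 - p.2‖ ^ s) ((densityMeasure f).prod (densityMeasure g)) := by
  rw [densityMeasure_prod hf hg, integrable_withDensity_iff_integrable_smul₀'
    (aemeasurable_density_prod hf hg)
    (Eventually.of_forall fun p => ENNReal.mul_lt_top ENNReal.ofReal_lt_top ENNReal.ofReal_lt_top)]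
  refine integrable_congr ?_
  filter_upwards [ae_density_prod hf0 hg0] with p hp
  rw [hp, smul_eq_mul, mul_comm]

theorem interaction_eq {f g : EuclideanSpace ℝ (Fin n) → ℝ} (hf : Integrable f)
    (hg : Integrable g) (hf0 : ∀ᵐ x, 0 ≤ f x) (hg0 : ∀ᵐ x, 0 ≤ g x) (s : ℝ) :
    interaction s f g = measureInteraction s (densityMeasure f) (densityMeasure g) := by
  rw [measureInteraction, densityMeasure_prod hf hg, integral_withDensity_eq_integral_toReal_smul₀
    (aemeasurable_density_prod hf hg)
    (Eventually.of_forall fun p => ENNReal.mul_lt_top ENNReal.ofReal_lt_top ENNReal.ofReal_lt_top)]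
  refine integral_congr_ae ?_
  filter_upwards [ae_density_prod hf0 hg0] with p hp
  rw [hp, smul_eq_mul, mul_comm]

theorem energyDist_eq {f g : EuclideanSpace ℝ (Fin n) → ℝ} (hf : IsProbDensity f)
    (hg : IsProbDensity g) (α : ℝ) :
    energyDist α f g = measureEnergy α (densityMeasure f) (densityMeasure g) := by
  rw [energyDist, measureEnergy, interaction_eq hf.2.1 hg.2.1 hf.1 hg.1,
    interaction_eq hf.2.1 hf.2.1 hf.1 hf.1, interaction_eq hg.2.1 hg.2.1 hg.1 hg.1]

theorem interaction_comm (s : ℝ) (f g : EuclideanSpace ℝ (Fin n) → ℝ) :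
    interaction s f g = interaction s g f := by
  unfold interaction
  rw [Measure.volume_eq_prod, ← integral_prod_swap]
  refine integral_congr_ae (Eventually.of_forall fun p => ?_)
  simp only [Prod.fst_swap, Prod.snd_swap]
  rw [norm_sub_rev, mul_comm (f p.2)]

theorem InteractionConverges.symm {s : ℝ} {f g : EuclideanSpace ℝ (Fin n) → ℝ}
    (h : InteractionConverges s f g) : InteractionConverges s g f := by
  unfold InteractionConverges at *
  rw [Measure.volume_eq_prod] at *
  refine h.swap.congr (Eventually.of_forall fun p => ?_)
  simp only [Function.comp, Prod.fst_swap, Prod.snd_swap]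
  rw [norm_sub_rev, mul_comm (f p.2)]

theorem negEnergyDist_eq {f g : EuclideanSpace ℝ (Fin n) → ℝ} (hf : IsProbDensity f)
    (hg : IsProbDensity g) {α : ℝ} (h : EnergyConverges (-(2 - α)) f g) :
    negEnergyDist α f g = measureNegEnergy α (densityMeasure f) (densityMeasure g) := by
  have h4 := h.1.symm
  obtain ⟨h1, h2, h3⟩ := h
  have : negEnergyDist α f g = interaction (-(2 - α)) f f + interaction (-(2 - α)) g g -
      2 * interaction (-(2 - α)) f g := by
    have e : negEnergyDist α f g = (interaction (-(2 - α)) f f + interaction (-(2 - α)) g g) -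
        (interaction (-(2 - α)) f g + interaction (-(2 - α)) g f) := by
      rw [negEnergyDist]
      unfold interaction
      refine Eq.trans ?_ ((integral_sub (h2.add h3) (h1.add h4)).trans
        (congrArg₂ (· - ·) (integral_add h2 h3) (integral_add h1 h4)))
      refine integral_congr_ae (Eventually.of_forall fun p => ?_)
      simp only [Pi.add_apply]
      ring
    rw [e, interaction_comm _ g f]
    ring
  rw [this, measureNegEnergy, interaction_eq hf.2.1 hg.2.1 hf.1 hg.1,
    interaction_eq hf.2.1 hf.2.1 hf.1 hf.1, interaction_eq hg.2.1 hg.2.1 hg.1 hg.1]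

/-- The Fourier transform of an integrable function is the difference of the characteristic
functions of its positive and negative parts. -/
theorem fourierHat_neg_eq {u : EuclideanSpace ℝ (Fin n) → ℝ} (hu : Integrable u)
    (ξ : EuclideanSpace ℝ (Fin n)) :
    fourierHat u (-ξ) = charFun (densityMeasure u) ξ -
      charFun (densityMeasure fun x => -u x) ξ := by
  have hi : ∀ v : EuclideanSpace ℝ (Fin n) → ℝ, Integrable v →
      Integrable fun x => max (v x) 0 • Complex.exp ((inner ℝ x ξ : ℝ) * Complex.I) := by
    intro v hv
    have := (hv.pos_part.ofReal (𝕜 := ℂ)).mul_bdd (c := 1)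
      (g := fun x => Complex.exp ((inner ℝ x ξ : ℝ) * Complex.I))
      (Continuous.aestronglyMeasurable (by fun_prop))
      (Eventually.of_forall fun x => by rw [Complex.norm_exp_ofReal_mul_I])
    exact this.congr (Eventually.of_forall fun x => (Complex.real_smul ..).symm)
  have hun : Integrable fun x => -u x := hu.neg
  rw [charFun_apply, charFun_apply, integral_densityMeasure hu, integral_densityMeasure hun,
    ← integral_sub (hi u hu) (hi _ hun), fourierHat]
  refine integral_congr_ae (Eventually.of_forall fun x => ?_)
  simp only [← sub_smul]
  have : max (u x) 0 - max (-u x) 0 = u x := by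
    rcases le_total 0 (u x) with h | h
    · rw [max_eq_left h, max_eq_right (by linarith), sub_zero]
    · rw [max_eq_right h, max_eq_left (by linarith)]
      ring
  rw [this, inner_neg_left, real_inner_comm, Complex.real_smul, mul_comm]
  congr 2
  push_cast
  ring

theorem densityMeasure_neg {f : EuclideanSpace ℝ (Fin n) → ℝ} (h0 : ∀ᵐ x, 0 ≤ f x) :
    densityMeasure (fun x => -f x) = 0 := by
  have : (fun x => ENNReal.ofReal (-f x)) =ᵐ[volume] 0 := by
    filter_upwards [h0] with x hx
    exact ENNReal.ofReal_of_nonpos (by linarith)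
  rw [densityMeasure, withDensity_congr_ae this, withDensity_zero]

theorem charFun_densityMeasure {f : EuclideanSpace ℝ (Fin n) → ℝ} (hf : Integrable f)
    (h0 : ∀ᵐ x, 0 ≤ f x) (ξ : EuclideanSpace ℝ (Fin n)) :
    charFun (densityMeasure f) ξ = fourierHat f (-ξ) := by
  rw [fourierHat_neg_eq hf, densityMeasure_neg h0]
  simp

theorem ae_eq_of_densityMeasure_eq {f g : EuclideanSpace ℝ (Fin n) → ℝ} (hf : IsProbDensity f)
    (hg : IsProbDensity g) (h : densityMeasure f = densityMeasure g) : f =ᵐ[volume] g := by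
  have : IsFiniteMeasure (densityMeasure f) := isFiniteMeasure_densityMeasure hf.2.1
  have h1 := (withDensity_eq_iff hf.2.1.1.aemeasurable.ennreal_ofReal
    hg.2.1.1.aemeasurable.ennreal_ofReal (by
      rw [← setLIntegral_univ, ← withDensity_apply _ MeasurableSet.univ]
      exact measure_ne_top (densityMeasure f) _)).1 h
  filter_upwards [h1, hf.1, hg.1] with x hx hfx hgx
  rw [← ENNReal.toReal_ofReal hfx, hx, ENNReal.toReal_ofReal hgx]

/-! ### The heat kernel, convolution, and uniqueness of weak solutions -/

/-- The law of the heat kernel at time `t`. -/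
def heatMeasure (n : ℕ) (t : ℝ) : Measure (EuclideanSpace ℝ (Fin n)) :=
  densityMeasure (heatKernel n t)

theorem heatKernel_nonneg {t : ℝ} (ht : 0 < t) (x : EuclideanSpace ℝ (Fin n)) :
    0 ≤ heatKernel n t x := by
  unfold heatKernel
  positivity

theorem heatKernel_eq (t : ℝ) : heatKernel n t = fun x : EuclideanSpace ℝ (Fin n) =>
    (4 * Real.pi * t) ^ (-((n : ℝ) / 2)) * Real.exp (-((4 * t)⁻¹ * ‖x‖ ^ 2)) := by
  funext x
  rw [heatKernel, div_eq_inv_mul (‖x‖ ^ 2)]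

theorem isProbDensity_heatKernel {t : ℝ} (ht : 0 < t) : IsProbDensity (heatKernel n t) := by
  have hb : 0 < (4 * t)⁻¹ := by positivity
  refine ⟨Eventually.of_forall (heatKernel_nonneg ht), ?_, ?_⟩
  · rw [heatKernel_eq]
    exact (integrable_gauss hb).const_mul _
  · rw [heatKernel_eq, integral_const_mul]
    have := GaussianFourier.integral_rexp_neg_mul_sq_norm (V := EuclideanSpace ℝ (Fin n)) hb
    simp only [neg_mul] at this
    rw [this, finrank_euclideanSpace, Fintype.card_fin, div_inv_eq_mul,
      show Real.pi * (4 * t) = 4 * Real.pi * t by ring, ← Real.rpow_add (by positivity),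
      neg_add_cancel, Real.rpow_zero]

theorem isProbabilityMeasure_heatMeasure {t : ℝ} (ht : 0 < t) :
    IsProbabilityMeasure (heatMeasure n t) :=
  (isProbDensity_heatKernel ht).isProbabilityMeasure

theorem charFun_heatMeasure {t : ℝ} (ht : 0 < t) (ξ : EuclideanSpace ℝ (Fin n)) :
    charFun (heatMeasure n t) ξ = Complex.exp (-(t * ‖ξ‖ ^ 2 : ℝ)) := by
  have hb : 0 < (4 * t)⁻¹ := by positivity
  have hpos : 0 < 4 * Real.pi * t := by positivity
  rw [heatMeasure, charFun_apply, integral_densityMeasure (isProbDensity_heatKernel ht).2.1]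
  have h1 : ∀ x : EuclideanSpace ℝ (Fin n), max (heatKernel n t x) 0 •
      Complex.exp ((inner ℝ x ξ : ℝ) * Complex.I) =
      ((4 * Real.pi * t) ^ (-((n : ℝ) / 2)) : ℝ) *
        Complex.exp (-(((4 * t)⁻¹ : ℝ) : ℂ) * (‖x‖ : ℂ) ^ 2 +
          Complex.I * ((inner ℝ ξ x : ℝ) : ℂ)) := by
    intro x
    rw [max_eq_left (heatKernel_nonneg ht x), heatKernel_eq, Complex.real_smul, Complex.ofReal_mul,
      mul_assoc, Complex.ofReal_exp, ← Complex.exp_add, real_inner_comm]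
    congr 2
    push_cast
    ring
  simp only [h1]
  rw [integral_const_mul, GaussianFourier.integral_cexp_neg_mul_sq_norm_add (by simpa using ht)]
  have e1 : ((Real.pi : ℂ) / (((4 * t)⁻¹ : ℝ) : ℂ)) = ((4 * Real.pi * t : ℝ) : ℂ) := by
    push_cast
    field_simp
  have e2 : ((Module.finrank ℝ (EuclideanSpace ℝ (Fin n)) : ℂ) / 2) =
      (((n : ℝ) / 2 : ℝ) : ℂ) := by
    rw [finrank_euclideanSpace, Fintype.card_fin]
    push_cast; ring
  rw [e1, e2, ← Complex.ofReal_cpow hpos.le, ← mul_assoc, ← Complex.ofReal_mul,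
    ← Real.rpow_add hpos, neg_add_cancel, Real.rpow_zero, Complex.ofReal_one, one_mul, Complex.I_sq]
  congr 1
  have : (t : ℂ) ≠ 0 := by exact_mod_cast ht.ne'
  push_cast
  field_simp

theorem heatMeasure_le (t : ℝ) (ht : 0 < t) :
    heatMeasure n t ≤ ENNReal.ofReal ((4 * Real.pi * t) ^ (-((n : ℝ) / 2))) • volume := by
  rw [heatMeasure, densityMeasure, ← withDensity_const]
  refine withDensity_mono (Eventually.of_forall fun x => ENNReal.ofReal_le_ofReal ?_)
  rw [heatKernel]
  refine mul_le_of_le_one_right (by positivity) (Real.exp_le_one_iff.2 ?_)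
  have : 0 ≤ ‖x‖ ^ 2 / (4 * t) := by positivity
  linarith

theorem integrable_rpow_heatMeasure {α t : ℝ} (hα0 : 0 ≤ α) (hα2 : α ≤ 2) (ht : 0 < t) :
    Integrable (fun x => ‖x‖ ^ α) (heatMeasure n t) := by
  rw [heatMeasure, integrable_densityMeasure_iff (isProbDensity_heatKernel ht).2.1
    (isProbDensity_heatKernel ht).1, heatKernel_eq]
  have hb : 0 < (8 * t)⁻¹ := by positivity
  -- half of the Gaussian exponent absorbs the power
  refine (((integrable_gauss (E := EuclideanSpace ℝ (Fin n)) hb).const_mul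
    ((4 * Real.pi * t) ^ (-((n : ℝ) / 2)))).const_mul (1 + 8 * t)).mono'
    (Continuous.aestronglyMeasurable ?_) (Eventually.of_forall fun x => ?_)
  · have : Continuous fun x : EuclideanSpace ℝ (Fin n) => ‖x‖ ^ α :=
      continuous_norm.rpow_const fun _ => Or.inr hα0
    fun_prop
  rw [Real.norm_of_nonneg (by positivity)]
  have h1 : ‖x‖ ^ α ≤ 1 + ‖x‖ ^ 2 := by
    rcases le_total ‖x‖ 1 with h | h
    · have := Real.rpow_le_one (norm_nonneg x) h hα0
      nlinarith [sq_nonneg ‖x‖]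
    · have := Real.rpow_le_rpow_of_exponent_le h hα2
      rw [Real.rpow_two] at this
      linarith
  have h2 : 1 + ‖x‖ ^ 2 ≤ (1 + 8 * t) * Real.exp ((8 * t)⁻¹ * ‖x‖ ^ 2) := by
    have h3 := Real.add_one_le_exp ((8 * t)⁻¹ * ‖x‖ ^ 2)
    have h4 : (1 + 8 * t) * ((8 * t)⁻¹ * ‖x‖ ^ 2 + 1) =
        (8 * t)⁻¹ * ‖x‖ ^ 2 + 1 + ‖x‖ ^ 2 + 8 * t := by
      field_simp
      ring
    have h5 : 0 ≤ (8 * t)⁻¹ * ‖x‖ ^ 2 := by positivity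
    have h6 := mul_le_mul_of_nonneg_left h3 (by positivity : 0 ≤ 1 + 8 * t)
    linarith
  have h7 : Real.exp (-((4 * t)⁻¹ * ‖x‖ ^ 2)) =
      Real.exp (-((8 * t)⁻¹ * ‖x‖ ^ 2)) * Real.exp (-((8 * t)⁻¹ * ‖x‖ ^ 2)) := by
    rw [← Real.exp_add]
    congr 1
    field_simp
    ring
  have h8 : Real.exp ((8 * t)⁻¹ * ‖x‖ ^ 2) * Real.exp (-((8 * t)⁻¹ * ‖x‖ ^ 2)) = 1 := by
    rw [← Real.exp_add, add_neg_cancel, Real.exp_zero]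
  have h9 : ‖x‖ ^ α * Real.exp (-((8 * t)⁻¹ * ‖x‖ ^ 2)) ≤ 1 + 8 * t := by
    have := mul_le_mul_of_nonneg_right (h1.trans h2)
      (Real.exp_pos (-((8 * t)⁻¹ * ‖x‖ ^ 2))).le
    rwa [mul_assoc, h8, mul_one] at this
  dsimp only
  rw [h7]
  have h10 : 0 ≤ (4 * Real.pi * t) ^ (-((n : ℝ) / 2)) * Real.exp (-((8 * t)⁻¹ * ‖x‖ ^ 2)) := by
    positivity
  calc _ = (‖x‖ ^ α * Real.exp (-((8 * t)⁻¹ * ‖x‖ ^ 2))) *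
        ((4 * Real.pi * t) ^ (-((n : ℝ) / 2)) * Real.exp (-((8 * t)⁻¹ * ‖x‖ ^ 2))) := by ring
    _ ≤ _ := mul_le_mul_of_nonneg_right h9 h10

theorem integrable_rpow_conv {α : ℝ} (hα0 : 0 ≤ α) (hα2 : α ≤ 2)
    {μ ν : Measure (EuclideanSpace ℝ (Fin n))} [IsFiniteMeasure μ] [IsFiniteMeasure ν]
    (hμ : Integrable (fun x => ‖x‖ ^ α) μ) (hν : Integrable (fun x => ‖x‖ ^ α) ν) :
    Integrable (fun x => ‖x‖ ^ α) (μ ∗ ν) := by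
  rw [Measure.conv, integrable_map_measure (by fun_prop) (by fun_prop)]
  refine (((hμ.comp_fst ν).add (hν.comp_snd μ)).const_mul 4).mono'
    (by fun_prop) (Eventually.of_forall fun p => ?_)
  rw [Function.comp, Real.norm_of_nonneg (by positivity)]
  exact (Real.rpow_le_rpow (norm_nonneg _) (norm_add_le _ _) hα0).trans
    (add_rpow_le_four_mul hα0 hα2 (norm_nonneg _) (norm_nonneg _))

theorem conv_le_smul_volume {μ ν : Measure (EuclideanSpace ℝ (Fin n))} [IsProbabilityMeasure μ]
    [SFinite ν] {B : ℝ≥0∞} (hν : ν ≤ B • volume) : μ ∗ ν ≤ B • volume := by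
  refine Measure.le_iff.2 fun s hs => ?_
  rw [Measure.conv, Measure.map_apply measurable_add hs, Measure.prod_apply (measurable_add hs)]
  calc _ ≤ ∫⁻ _, B * volume s ∂μ := by
        refine lintegral_mono fun x => (hν _).trans_eq ?_
        have : Prod.mk x ⁻¹' ((fun p : EuclideanSpace ℝ (Fin n) × EuclideanSpace ℝ (Fin n) =>
            p.1 + p.2) ⁻¹' s) = (fun y => x + y) ⁻¹' s := rfl
        rw [this, Measure.smul_apply, measure_preimage_add, smul_eq_mul]
    _ = _ := by simp

/-- A measure of bounded density has convergent Riesz interactions of order `-(2-α) > -n` with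
every finite measure. -/
theorem integrable_riesz (hn : 2 ≤ n) {α : ℝ} (hα0 : 0 < α) (hα2 : α < 2)
    {μ ν : Measure (EuclideanSpace ℝ (Fin n))} [IsFiniteMeasure μ] [IsFiniteMeasure ν] {B : ℝ≥0∞}
    (hB : B ≠ ⊤) (hν : ν ≤ B • volume) :
    Integrable (fun p : EuclideanSpace ℝ (Fin n) × EuclideanSpace ℝ (Fin n) =>
      ‖p.1 - p.2‖ ^ (-(2 - α))) (μ.prod ν) := by
  have hn' : (2 : ℝ) ≤ n := by exact_mod_cast hn
  have hball := (integral_ball_rpow hn (q := 2 - α) (by linarith) one_pos).1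
  set g : ℝ → ℝ := (Set.Iio (1 : ℝ)).indicator fun r => r ^ (-(2 - α)) with hg
  set L := ∫⁻ x : EuclideanSpace ℝ (Fin n), ENNReal.ofReal (g ‖x‖) with hL
  have hLfin : L ≠ ⊤ := by
    have := hball.2
    rw [hasFiniteIntegral_iff_enorm] at this
    refine (lt_of_le_of_lt (lintegral_mono fun x => ?_) this).ne
    exact Real.ofReal_le_enorm _
  have hbound : ∀ r : ℝ, 0 ≤ r → ENNReal.ofReal (r ^ (-(2 - α))) ≤ ENNReal.ofReal (g r) + 1 := by
    intro r hr
    by_cases h : r ∈ Set.Iio (1 : ℝ)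
    · rw [hg, Set.indicator_of_mem h]
      exact le_self_add
    · have h1 : 1 ≤ r := not_lt.1 h
      refine le_add_left ?_
      rw [ENNReal.ofReal_le_one]
      exact Real.rpow_le_one_of_one_le_of_nonpos h1 (by linarith)
  refine ⟨Measurable.aestronglyMeasurable (by fun_prop), ?_⟩
  rw [hasFiniteIntegral_iff_enorm]
  have hm : Measurable fun p : EuclideanSpace ℝ (Fin n) × EuclideanSpace ℝ (Fin n) =>
      ENNReal.ofReal (‖p.1 - p.2‖ ^ (-(2 - α))) := by fun_prop
  have he : ∀ p : EuclideanSpace ℝ (Fin n) × EuclideanSpace ℝ (Fin n),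
      ‖‖p.1 - p.2‖ ^ (-(2 - α))‖ₑ = ENNReal.ofReal (‖p.1 - p.2‖ ^ (-(2 - α))) := fun p =>
    Real.enorm_of_nonneg (by positivity)
  simp only [he]
  rw [lintegral_prod _ hm.aemeasurable]
  calc _ ≤ ∫⁻ _, (B * L + ν Set.univ) ∂μ := by
        refine lintegral_mono fun x => ?_
        calc _ ≤ ∫⁻ y, (ENNReal.ofReal (g ‖x - y‖) + 1) ∂ν :=
              lintegral_mono fun y => hbound _ (norm_nonneg _)
          _ = (∫⁻ y, ENNReal.ofReal (g ‖x - y‖) ∂ν) + ν Set.univ := by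
              rw [lintegral_add_right _ measurable_const, lintegral_one]
          _ ≤ B * L + ν Set.univ := by
              refine add_le_add_left ((lintegral_mono' hν le_rfl).trans_eq ?_) _
              rw [lintegral_smul_measure, smul_eq_mul,
                lintegral_sub_left_eq_self (fun z : EuclideanSpace ℝ (Fin n) =>
                  ENNReal.ofReal (g ‖z‖)) x]
    _ < ⊤ := by
        rw [lintegral_const]
        exact ENNReal.mul_lt_top (ENNReal.add_lt_top.2
          ⟨ENNReal.mul_lt_top hB.lt_top hLfin.lt_top, measure_lt_top _ _⟩) (measure_lt_top _ _)

theorem nullSingletonClass_of_le (hn : 2 ≤ n) {ν : Measure (EuclideanSpace ℝ (Fin n))} {B : ℝ≥0∞}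
    (hν : ν ≤ B • volume) : NullSingletonClass ν := by
  have : Nonempty (Fin n) := ⟨⟨0, by omega⟩⟩
  refine ⟨fun x => le_antisymm ((hν _).trans_eq ?_) zero_le⟩
  simp

/-- Uniqueness of weak solutions: at time `t` a solution starting from a probability density is
the density of the convolution of its initial law with the heat kernel. The Fourier transforms
agree, so that the positive part of `f t` has the law of this convolution plus the negative part;
hence the negative part vanishes. -/
theorem IsHeatSolution.isProbDensity_and_eq_conv {f : ℝ → EuclideanSpace ℝ (Fin n) → ℝ}
    (hf : IsHeatSolution f) (hf0 : IsProbDensity (f 0)) {t : ℝ} (ht : 0 < t) :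
    IsProbDensity (f t) ∧ densityMeasure (f t) = densityMeasure (f 0) ∗ heatMeasure n t := by
  have hi := hf.integrable t ht.le
  have hin : Integrable fun x => -f t x := hi.neg
  have _ := hf0.isProbabilityMeasure
  have _ := isProbabilityMeasure_heatMeasure (n := n) ht
  have _ := isFiniteMeasure_densityMeasure hi
  have _ := isFiniteMeasure_densityMeasure hin
  have hadd : densityMeasure (f t) =
      densityMeasure (f 0) ∗ heatMeasure n t + densityMeasure fun x => -f t x := by
    refine Measure.ext_of_charFun (funext fun ξ => ?_)
    have h1 := fourierHat_neg_eq hi ξ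
    rw [hf.fourierHat_eq ht, norm_neg, ← charFun_densityMeasure hf0.2.1 hf0.1] at h1
    have h2 : charFun (densityMeasure (f 0) ∗ heatMeasure n t + densityMeasure fun x => -f t x) ξ =
        charFun (densityMeasure (f 0) ∗ heatMeasure n t) ξ +
          charFun (densityMeasure fun x => -f t x) ξ := by
      have hb : ∀ ρ : Measure (EuclideanSpace ℝ (Fin n)), IsFiniteMeasure ρ →
          Integrable (fun x => Complex.exp ((inner ℝ x ξ : ℝ) * Complex.I)) ρ := fun ρ _ =>
        (integrable_const (1 : ℝ)).mono' (Continuous.aestronglyMeasurable (by fun_prop))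
          (Eventually.of_forall fun x => by rw [Complex.norm_exp_ofReal_mul_I])
      simp only [charFun_apply]
      exact integral_add_measure (hb _ inferInstance) (hb _ inferInstance)
    rw [h2, charFun_conv, charFun_heatMeasure ht, mul_comm, h1]
    ring
  have hle : (fun x => ENNReal.ofReal (-f t x)) ≤ᵐ[volume] fun x => ENNReal.ofReal (f t x) := by
    refine ae_le_of_forall_setLIntegral_le_of_sigmaFinite₀ hin.1.aemeasurable.ennreal_ofReal
      fun s hs _ => ?_
    rw [← withDensity_apply _ hs, ← withDensity_apply _ hs]
    change densityMeasure (fun x => -f t x) s ≤ densityMeasure (f t) s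
    rw [hadd]
    exact le_add_left le_rfl
  have hnn : ∀ᵐ x, 0 ≤ f t x := by
    filter_upwards [hle] with x hx
    by_contra h
    rw [ENNReal.ofReal_of_nonpos (not_le.1 h).le, nonpos_iff_eq_zero, ENNReal.ofReal_eq_zero] at hx
    linarith
  have heq : densityMeasure (f t) = densityMeasure (f 0) ∗ heatMeasure n t := by
    rw [hadd, densityMeasure_neg hnn, add_zero]
  refine ⟨⟨hnn, hi, ?_⟩, heq⟩
  have h1 : (densityMeasure (f t)) Set.univ = 1 := by
    rw [heq]
    exact measure_univ
  rw [densityMeasure, withDensity_apply _ MeasurableSet.univ, Measure.restrict_univ,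
    ← ofReal_integral_eq_lintegral_ofReal hi hnn, ENNReal.ofReal_eq_one] at h1
  exact h1

/-! ### Decay of the energy distance -/

theorem norm_sq_charFun_conv_sub {t : ℝ} (ht : 0 < t)
    {μ ν : Measure (EuclideanSpace ℝ (Fin n))} [IsFiniteMeasure μ] [IsFiniteMeasure ν]
    (ξ : EuclideanSpace ℝ (Fin n)) :
    ‖charFun (μ ∗ heatMeasure n t) ξ - charFun (ν ∗ heatMeasure n t) ξ‖ ^ 2 =
      Real.exp (-(2 * t * ‖ξ‖ ^ 2)) * ‖charFun μ ξ - charFun ν ξ‖ ^ 2 := by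
  have _ := isProbabilityMeasure_heatMeasure (n := n) ht
  rw [charFun_conv, charFun_conv, charFun_heatMeasure ht, ← sub_mul, norm_mul, mul_pow,
    Complex.norm_exp, ← Complex.ofReal_neg, Complex.ofReal_re, ← Real.exp_nat_mul, mul_comm]
  congr 2
  push_cast
  ring

theorem integrable_riesz_heat (hn : 2 ≤ n) {α : ℝ} (hα0 : 0 < α) (hα2 : α < 2)
    (μ ν : Measure (EuclideanSpace ℝ (Fin n))) [IsProbabilityMeasure μ] [IsProbabilityMeasure ν]
    {t : ℝ} (ht : 0 < t) :
    Integrable (fun p : EuclideanSpace ℝ (Fin n) × EuclideanSpace ℝ (Fin n) =>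
      ‖p.1 - p.2‖ ^ (-(2 - α))) ((μ ∗ heatMeasure n t).prod (ν ∗ heatMeasure n t)) :=
  have _ := isProbabilityMeasure_heatMeasure (n := n) ht
  integrable_riesz hn hα0 hα2 ENNReal.ofReal_ne_top (conv_le_smul_volume (heatMeasure_le t ht))

/-- The energy decay for the heat flow of two probability measures. Only the bound `d` on the
difference quotient of the characteristic functions enters the constant, and it is preserved by the
flow; the initial measures need not have densities. -/
theorem measureEnergy_heat_decay (hn : 2 ≤ n) {α : ℝ} (hα0 : 0 < α) (hα2 : α < 2)
    {μ ν : Measure (EuclideanSpace ℝ (Fin n))} [IsProbabilityMeasure μ] [IsProbabilityMeasure ν]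
    (hμ : Integrable (fun x => ‖x‖ ^ α) μ) (hν : Integrable (fun x => ‖x‖ ^ α) ν)
    {d : ℝ} (hd0 : 0 ≤ d) (hd : ∀ ξ, ‖charFun μ ξ - charFun ν ξ‖ ≤ d * ‖ξ‖) :
    0 ≤ measureEnergy α μ ν ∧ ∀ t, 0 < t →
      HasDerivAt (fun s => measureEnergy α (μ ∗ heatMeasure n s) (ν ∗ heatMeasure n s))
        (-2 * α * (n - 2 + α) *
          measureNegEnergy α (μ ∗ heatMeasure n t) (ν ∗ heatMeasure n t)) t ∧
      -2 * α * (n - 2 + α) * measureNegEnergy α (μ ∗ heatMeasure n t) (ν ∗ heatMeasure n t) ≤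
        -decayConst n α d * measureEnergy α (μ ∗ heatMeasure n t) (ν ∗ heatMeasure n t) ^
          ((4 - α) / (2 - α)) ∧
      measureEnergy α (μ ∗ heatMeasure n t) (ν ∗ heatMeasure n t) ≤
        (measureEnergy α μ ν ^ (-(2 / (2 - α))) + decayConst n α d * (2 / (2 - α)) * t) ^
          (-((2 - α) / 2)) ∧
      measureEnergy α (μ ∗ heatMeasure n t) (ν ∗ heatMeasure n t) ≤
        (decayConst n α d * (2 / (2 - α)) * t) ^ (-((2 - α) / 2)) := by
  have h2α : 0 < 2 - α := by linarith
  have hc := cConst_pos hn hα0 hα2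
  set w : EuclideanSpace ℝ (Fin n) → ℝ := fun ξ => ‖charFun μ ξ - charFun ν ξ‖ ^ 2 with hw
  have hw0 : ∀ ξ, 0 ≤ w ξ := fun ξ => sq_nonneg _
  have hwd : ∀ ξ, w ξ ≤ d ^ 2 * ‖ξ‖ ^ 2 := fun ξ => by
    rw [← mul_pow]
    exact pow_le_pow_left₀ (norm_nonneg _) (hd ξ) 2
  obtain ⟨hwi, hE0⟩ := measureEnergy_eq_fourier hn hα0 hα2 hμ hν
  set E : ℝ → ℝ := fun s => measureEnergy α (μ ∗ heatMeasure n s) (ν ∗ heatMeasure n s) with hE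
  set I : ℝ → ℝ := fun s => measureNegEnergy α (μ ∗ heatMeasure n s) (ν ∗ heatMeasure n s) with hI
  have hEt : ∀ s, 0 < s →
      Integrable (fun ξ => Real.exp (-(2 * s * ‖ξ‖ ^ 2)) * w ξ * ‖ξ‖ ^ (-(n + α))) ∧
      E s = cConst n α * ∫ ξ, Real.exp (-(2 * s * ‖ξ‖ ^ 2)) * w ξ * ‖ξ‖ ^ (-(n + α)) := by
    intro s hs
    have _ := isProbabilityMeasure_heatMeasure (n := n) hs
    have hm := integrable_rpow_heatMeasure (n := n) hα0.le hα2.le hs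
    have := measureEnergy_eq_fourier hn hα0 hα2 (integrable_rpow_conv hα0.le hα2.le hμ hm)
      (integrable_rpow_conv hα0.le hα2.le hν hm)
    simpa only [norm_sq_charFun_conv_sub hs] using this
  have hIt : ∀ s, 0 < s →
      Integrable (fun ξ => Real.exp (-(2 * s * ‖ξ‖ ^ 2)) * w ξ * ‖ξ‖ ^ (-(n - 2 + α))) ∧
      I s = dConst n α *
        ∫ ξ, Real.exp (-(2 * s * ‖ξ‖ ^ 2)) * w ξ * ‖ξ‖ ^ (-(n - 2 + α)) := by
    intro s hs
    have _ := isProbabilityMeasure_heatMeasure (n := n) hs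
    have _ := nullSingletonClass_of_le hn
      (conv_le_smul_volume (μ := μ) (heatMeasure_le (n := n) s hs))
    have _ := nullSingletonClass_of_le hn
      (conv_le_smul_volume (μ := ν) (heatMeasure_le (n := n) s hs))
    have := measureNegEnergy_eq_fourier hn hα0 hα2 (integrable_riesz_heat hn hα0 hα2 μ ν hs)
      (integrable_riesz_heat hn hα0 hα2 μ μ hs) (integrable_riesz_heat hn hα0 hα2 ν ν hs)
    simpa only [norm_sq_charFun_conv_sub hs] using this
  have hexp : ∀ s, 0 < s → ∀ ξ : EuclideanSpace ℝ (Fin n),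
      Real.exp (-(2 * s * ‖ξ‖ ^ 2)) ≤ 1 := by
    intro s hs ξ
    refine Real.exp_le_one_iff.2 ?_
    have : 0 ≤ 2 * s * ‖ξ‖ ^ 2 := by positivity
    linarith
  have hwt0 : ∀ s ξ, 0 ≤ Real.exp (-(2 * s * ‖ξ‖ ^ 2)) * w ξ := fun s ξ =>
    mul_nonneg (Real.exp_pos _).le (hw0 ξ)
  have hwtw : ∀ s, 0 < s → ∀ ξ, Real.exp (-(2 * s * ‖ξ‖ ^ 2)) * w ξ ≤ w ξ := fun s hs ξ =>
    mul_le_of_le_one_left (hw0 ξ) (hexp s hs ξ)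
  have hEnn : ∀ s, 0 < s → 0 ≤ E s := by
    intro s hs
    rw [(hEt s hs).2]
    exact mul_nonneg hc.le (integral_nonneg fun ξ => mul_nonneg (hwt0 s ξ) (by positivity))
  have hE0nn : 0 ≤ measureEnergy α μ ν := by
    rw [hE0]
    exact mul_nonneg hc.le (integral_nonneg fun ξ => mul_nonneg (hw0 ξ) (by positivity))
  have hEle : ∀ s, 0 < s → E s ≤ measureEnergy α μ ν := by
    intro s hs
    rw [(hEt s hs).2, hE0]
    refine mul_le_mul_of_nonneg_left (integral_mono (hEt s hs).1 hwi fun ξ => ?_) hc.le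
    exact mul_le_mul_of_nonneg_right (hwtw s hs ξ) (by positivity)
  have hderiv : ∀ s, 0 < s → HasDerivAt E (-2 * α * (n - 2 + α) * I s) s := by
    intro s hs
    have h1 := (hasDerivAt_integral_heat hn hα0 hw0 hwi hs).const_mul (cConst n α)
    refine (h1.congr_of_eventuallyEq ?_).congr_deriv ?_
    · filter_upwards [Ioi_mem_nhds hs] with r hr
      exact (hEt r hr).2
    · rw [(hIt s hs).2, cConst_eq_mul_dConst hn hα0 hα2]
      ring
  have hineq : ∀ s, 0 < s → -2 * α * (n - 2 + α) * I s ≤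
      -decayConst n α d * E s ^ ((4 - α) / (2 - α)) := by
    intro s hs
    have := decayConst_mul_rpow_le hn hα0 hα2 hd0 (hwt0 s)
      (fun ξ => (hwtw s hs ξ).trans (hwd ξ)) (hEt s hs).1 (hIt s hs).1
    rw [← (hEt s hs).2, ← (hIt s hs).2] at this
    linarith
  have hC0 : 0 ≤ decayConst n α d := by
    rcases hd0.eq_or_lt with rfl | hd'
    · rw [decayConst_zero hα2]
    · exact (decayConst_pos hn hα0 hα2 hd').le
  refine ⟨hE0nn, fun t ht => ?_⟩
  have hmain : E t ≤ (measureEnergy α μ ν ^ (-(2 / (2 - α))) +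
      decayConst n α d * (2 / (2 - α)) * t) ^ (-((2 - α) / 2)) := by
    have hp : (4 - α) / (2 - α) = 1 + 2 / (2 - α) := by
      field_simp
      ring
    have := le_of_hasDerivAt_le_neg_rpow hC0 (by positivity : 0 < 2 / (2 - α)) hEnn hEle hderiv
      (fun s hs => by rw [← hp]; exact hineq s hs) ht
    rwa [inv_div] at this
  refine ⟨hderiv t ht, hineq t ht, hmain, ?_⟩
  rcases hd0.eq_or_lt with rfl | hd'
  · -- both sides vanish when `μ` and `ν` have the same characteristic function
    have hz : ∀ ξ, w ξ = 0 := fun ξ => le_antisymm (by simpa using hwd ξ) (hw0 ξ)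
    have : E t = 0 := by
      rw [(hEt t ht).2]
      simp [hz]
    change E t ≤ _
    rw [this, decayConst_zero hα2]
    exact Real.rpow_nonneg (by simp) _
  · have hC := decayConst_pos hn hα0 hα2 hd'
    refine hmain.trans (Real.rpow_le_rpow_of_nonpos (by positivity) ?_ ?_)
    · have := Real.rpow_nonneg hE0nn (-(2 / (2 - α)))
      linarith
    · have : 0 < (2 - α) / 2 := by positivity
      linarith

/-- A finite supremum of `|F(ξ)|/|ξ|` bounds `F` linearly. -/
theorem norm_le_of_iSup_ne_top {F : EuclideanSpace ℝ (Fin n) → ℂ} (h0 : F 0 = 0)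
    (hF : (⨆ (ξ : EuclideanSpace ℝ (Fin n)) (_ : ξ ≠ 0), ENNReal.ofReal (‖F ξ‖ / ‖ξ‖)) ≠ ⊤)
    (ξ : EuclideanSpace ℝ (Fin n)) :
    ‖F ξ‖ ≤ (⨆ (ξ : EuclideanSpace ℝ (Fin n)) (_ : ξ ≠ 0),
      ENNReal.ofReal (‖F ξ‖ / ‖ξ‖)).toReal * ‖ξ‖ := by
  rcases eq_or_ne ξ 0 with rfl | hξ
  · simp [h0]
  rw [← div_le_iff₀ (norm_pos_iff.2 hξ), ← ENNReal.ofReal_le_iff_le_toReal hF]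
  exact le_iSup₂_of_le ξ hξ le_rfl

theorem fourierHat_zero {f : EuclideanSpace ℝ (Fin n) → ℝ} (hf : IsProbDensity f) :
    fourierHat f 0 = 1 := by
  have _ := hf.isProbabilityMeasure
  have := charFun_densityMeasure hf.2.1 hf.1 0
  rw [neg_zero, charFun_zero, probReal_univ] at this
  rw [← this, Complex.ofReal_one]

theorem norm_charFun_sub_le_fourierDist {f g : EuclideanSpace ℝ (Fin n) → ℝ}
    (hf : IsProbDensity f) (hg : IsProbDensity g) (h : fourierDist f g ≠ ⊤)
    (ξ : EuclideanSpace ℝ (Fin n)) :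
    ‖charFun (densityMeasure f) ξ - charFun (densityMeasure g) ξ‖ ≤
      (fourierDist f g).toReal * ‖ξ‖ := by
  rw [charFun_densityMeasure hf.2.1 hf.1, charFun_densityMeasure hg.2.1 hg.1, ← norm_neg ξ]
  exact norm_le_of_iSup_ne_top (F := fun ξ => fourierHat f ξ - fourierHat g ξ)
    (by simp only [fourierHat_zero hf, fourierHat_zero hg, sub_self]) h (-ξ)

theorem norm_charFun_sub_le_fourierDistDirac {f : EuclideanSpace ℝ (Fin n) → ℝ}
    (hf : IsProbDensity f) (h : fourierDistDirac f ≠ ⊤) (ξ : EuclideanSpace ℝ (Fin n)) :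
    ‖charFun (densityMeasure f) ξ - charFun (Measure.dirac 0) ξ‖ ≤
      (fourierDistDirac f).toReal * ‖ξ‖ := by
  rw [charFun_densityMeasure hf.2.1 hf.1, charFun_dirac, inner_zero_left, Complex.ofReal_zero,
    zero_mul, Complex.exp_zero, ← norm_neg ξ]
  exact norm_le_of_iSup_ne_top (F := fun ξ => fourierHat f ξ - 1)
    (by simp only [fourierHat_zero hf, sub_self]) h (-ξ)

/-- Two finite measures with characteristic functions at distance `d₁ = 0` are equal. -/
theorem eq_of_norm_charFun_sub_le_zero {μ ν : Measure (EuclideanSpace ℝ (Fin n))}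
    [IsFiniteMeasure μ] [IsFiniteMeasure ν]
    (h : ∀ ξ, ‖charFun μ ξ - charFun ν ξ‖ ≤ 0 * ‖ξ‖) : μ = ν :=
  Measure.ext_of_charFun (funext fun ξ => sub_eq_zero.1 (norm_le_zero_iff.1 (by simpa using h ξ)))

theorem HasMoment.integrable_densityMeasure {α : ℝ} {f : EuclideanSpace ℝ (Fin n) → ℝ}
    (hfα : HasMoment α f) (hf : IsProbDensity f) :
    Integrable (fun x => ‖x‖ ^ α) (densityMeasure f) :=
  (integrable_densityMeasure_iff hf.2.1 hf.1 _).2 hfα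

theorem energyConverges_iff {f g : EuclideanSpace ℝ (Fin n) → ℝ} (hf : IsProbDensity f)
    (hg : IsProbDensity g) (s : ℝ) : EnergyConverges s f g ↔
      (Integrable (fun p : EuclideanSpace ℝ (Fin n) × EuclideanSpace ℝ (Fin n) =>
        ‖p.1 - p.2‖ ^ s) ((densityMeasure f).prod (densityMeasure g)) ∧
      Integrable (fun p : EuclideanSpace ℝ (Fin n) × EuclideanSpace ℝ (Fin n) =>
        ‖p.1 - p.2‖ ^ s) ((densityMeasure f).prod (densityMeasure f)) ∧
      Integrable (fun p : EuclideanSpace ℝ (Fin n) × EuclideanSpace ℝ (Fin n) =>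
        ‖p.1 - p.2‖ ^ s) ((densityMeasure g).prod (densityMeasure g))) := by
  rw [EnergyConverges, interactionConverges_iff hf.2.1 hg.2.1 hf.1 hg.1,
    interactionConverges_iff hf.2.1 hf.2.1 hf.1 hf.1,
    interactionConverges_iff hg.2.1 hg.2.1 hg.1 hg.1]

theorem energyConverges_of_moments {α : ℝ} (hα0 : 0 < α) (hα2 : α < 2)
    {f g : EuclideanSpace ℝ (Fin n) → ℝ} (hf : IsProbDensity f) (hg : IsProbDensity g)
    (hfα : Integrable (fun x => ‖x‖ ^ α) (densityMeasure f))
    (hgα : Integrable (fun x => ‖x‖ ^ α) (densityMeasure g)) : EnergyConverges α f g := by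
  have _ := hf.isProbabilityMeasure
  have _ := hg.isProbabilityMeasure
  exact (energyConverges_iff hf hg α).2 ⟨integrable_norm_sub_rpow hα0.le hα2.le hfα hgα,
    integrable_norm_sub_rpow hα0.le hα2.le hfα hfα, integrable_norm_sub_rpow hα0.le hα2.le hgα hgα⟩

theorem energyConverges_heat (hn : 2 ≤ n) {α : ℝ} (hα0 : 0 < α) (hα2 : α < 2) {t : ℝ} (ht : 0 < t)
    {μ ν : Measure (EuclideanSpace ℝ (Fin n))} [IsProbabilityMeasure μ] [IsProbabilityMeasure ν]
    (hμ : Integrable (fun x => ‖x‖ ^ α) μ) (hν : Integrable (fun x => ‖x‖ ^ α) ν)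
    {f g : EuclideanSpace ℝ (Fin n) → ℝ} (hf : IsProbDensity f) (hg : IsProbDensity g)
    (hfμ : densityMeasure f = μ ∗ heatMeasure n t) (hgν : densityMeasure g = ν ∗ heatMeasure n t) :
    EnergyConverges α f g ∧ EnergyConverges (-(2 - α)) f g := by
  have _ := isProbabilityMeasure_heatMeasure (n := n) ht
  have hm := integrable_rpow_heatMeasure (n := n) hα0.le hα2.le ht
  refine ⟨energyConverges_of_moments hα0 hα2 hf hg ?_ ?_, (energyConverges_iff hf hg _).2 ?_⟩
  · rw [hfμ]
    exact integrable_rpow_conv hα0.le hα2.le hμ hm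
  · rw [hgν]
    exact integrable_rpow_conv hα0.le hα2.le hν hm
  · rw [hfμ, hgν]
    exact ⟨integrable_riesz_heat hn hα0 hα2 _ _ ht, integrable_riesz_heat hn hα0 hα2 _ _ ht,
      integrable_riesz_heat hn hα0 hα2 _ _ ht⟩

theorem energyDistDirac_eq {f : EuclideanSpace ℝ (Fin n) → ℝ} (hf : IsProbDensity f) {α : ℝ}
    (hα0 : 0 < α) :
    energyDistDirac α f = measureEnergy α (densityMeasure f) (Measure.dirac 0) := by
  have h1 : measureInteraction α (densityMeasure f) (Measure.dirac 0) = ∫ x, ‖x‖ ^ α * f x := by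
    rw [measureInteraction, Measure.prod_dirac, integral_map (by fun_prop)
      (Measurable.aestronglyMeasurable (by fun_prop)), integral_densityMeasure hf.2.1]
    refine integral_congr_ae ?_
    filter_upwards [hf.1] with x hx
    rw [max_eq_left hx, sub_zero, smul_eq_mul, mul_comm]
  have h2 : measureInteraction α (Measure.dirac (0 : EuclideanSpace ℝ (Fin n)))
      (Measure.dirac 0) = 0 := by
    rw [measureInteraction, Measure.dirac_prod_dirac, integral_dirac]
    simp [Real.zero_rpow hα0.ne']
  rw [energyDistDirac, measureEnergy, h1, h2, interaction_eq hf.2.1 hf.2.1 hf.1 hf.1, sub_zero]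

theorem densityMeasure_ne_dirac (hn : 2 ≤ n) (f : EuclideanSpace ℝ (Fin n) → ℝ) :
    densityMeasure f ≠ Measure.dirac 0 := by
  have : Nonempty (Fin n) := ⟨⟨0, by omega⟩⟩
  intro h
  have h1 : densityMeasure f {0} = 0 := withDensity_absolutelyContinuous _ _ (measure_singleton _)
  rw [h] at h1
  simp at h1

end HeatEnergy

end

theorem mainTheorem1 (n : ℕ) (hn : 2 ≤ n) (α : ℝ) (hα0 : 0 < α) (hα2 : α < 2)
    (f : ℝ → EuclideanSpace ℝ (Fin n) → ℝ) (hf : HeatEnergy.IsHeatSolution f)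
    (hf0 : HeatEnergy.IsProbDensity (f 0)) (hfα : HeatEnergy.HasMoment α (f 0)) :
    -- two solutions whose initial data are probability densities
    (∀ g : ℝ → EuclideanSpace ℝ (Fin n) → ℝ, HeatEnergy.IsHeatSolution g →
      HeatEnergy.IsProbDensity (g 0) → HeatEnergy.HasMoment α (g 0) →
      HeatEnergy.fourierDist (f 0) (g 0) ≠ ⊤ →
      ∀ C : ℝ, C = HeatEnergy.decayConst n α (HeatEnergy.fourierDist (f 0) (g 0)).toReal →
      (¬ f 0 =ᵐ[volume] g 0 → 0 < C) ∧
      (∀ t, 0 ≤ t → HeatEnergy.EnergyConverges α (f t) (g t)) ∧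
      (∀ t, 0 < t →
        HeatEnergy.EnergyConverges (-(2 - α)) (f t) (g t) ∧
        HasDerivAt (fun s => HeatEnergy.energyDist α (f s) (g s))
          (-2 * α * (n - 2 + α) * HeatEnergy.negEnergyDist α (f t) (g t)) t ∧
        -2 * α * (n - 2 + α) * HeatEnergy.negEnergyDist α (f t) (g t) ≤
          -C * HeatEnergy.energyDist α (f t) (g t) ^ ((4 - α) / (2 - α))) ∧
      (∀ t, 0 ≤ t →
        HeatEnergy.energyDist α (f t) (g t) ≤
          (HeatEnergy.energyDist α (f 0) (g 0) ^ (-(2 / (2 - α))) + C * (2 / (2 - α)) * t) ^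
            (-((2 - α) / 2))) ∧
      (∀ t, 0 < t →
        HeatEnergy.energyDist α (f t) (g t) ≤ (C * (2 / (2 - α)) * t) ^ (-((2 - α) / 2)))) ∧
    -- a solution and the Gaussian fundamental solution, whose initial datum is the Dirac mass at 0
    (HeatEnergy.fourierDistDirac (f 0) ≠ ⊤ →
      ∀ C : ℝ, C = HeatEnergy.decayConst n α (HeatEnergy.fourierDistDirac (f 0)).toReal →
      0 < C ∧
      (∀ t, 0 < t →
        HeatEnergy.EnergyConverges α (f t) (HeatEnergy.heatKernel n t) ∧
        HeatEnergy.EnergyConverges (-(2 - α)) (f t) (HeatEnergy.heatKernel n t) ∧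
        HasDerivAt (fun s => HeatEnergy.energyDist α (f s) (HeatEnergy.heatKernel n s))
          (-2 * α * (n - 2 + α) *
            HeatEnergy.negEnergyDist α (f t) (HeatEnergy.heatKernel n t)) t ∧
        -2 * α * (n - 2 + α) * HeatEnergy.negEnergyDist α (f t) (HeatEnergy.heatKernel n t) ≤
          -C * HeatEnergy.energyDist α (f t) (HeatEnergy.heatKernel n t) ^
            ((4 - α) / (2 - α)) ∧
        HeatEnergy.energyDist α (f t) (HeatEnergy.heatKernel n t) ≤
          (HeatEnergy.energyDistDirac α (f 0) ^ (-(2 / (2 - α))) + C * (2 / (2 - α)) * t) ^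
            (-((2 - α) / 2)) ∧
        HeatEnergy.energyDist α (f t) (HeatEnergy.heatKernel n t) ≤
          (C * (2 / (2 - α)) * t) ^ (-((2 - α) / 2)))) := by
  have hF0 := hf0.isProbabilityMeasure
  have hFm := hfα.integrable_densityMeasure hf0
  have hft : ∀ t, 0 < t → HeatEnergy.IsProbDensity (f t) ∧ HeatEnergy.densityMeasure (f t) =
      Measure.conv (HeatEnergy.densityMeasure (f 0)) (HeatEnergy.heatMeasure n t) := fun t ht =>
    hf.isProbDensity_and_eq_conv hf0 ht
  refine ⟨fun g hg hg0 hgα hd C hC => ?_, fun hd C hC => ?_⟩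
  · have hG0 := hg0.isProbabilityMeasure
    have hGm := hgα.integrable_densityMeasure hg0
    have hgt : ∀ t, 0 < t → HeatEnergy.IsProbDensity (g t) ∧ HeatEnergy.densityMeasure (g t) =
        Measure.conv (HeatEnergy.densityMeasure (g 0)) (HeatEnergy.heatMeasure n t) := fun t ht =>
      hg.isProbDensity_and_eq_conv hg0 ht
    have hdist := HeatEnergy.norm_charFun_sub_le_fourierDist hf0 hg0 hd
    have hconv := fun t (ht : 0 < t) => HeatEnergy.energyConverges_heat hn hα0 hα2 ht hFm hGm
      (hft t ht).1 (hgt t ht).1 (hft t ht).2 (hgt t ht).2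
    obtain ⟨hE0, hdecay⟩ := HeatEnergy.measureEnergy_heat_decay hn hα0 hα2 hFm hGm
      ENNReal.toReal_nonneg hdist
    have hE : ∀ t, 0 < t → HeatEnergy.energyDist α (f t) (g t) = HeatEnergy.measureEnergy α
        (Measure.conv (HeatEnergy.densityMeasure (f 0)) (HeatEnergy.heatMeasure n t))
        (Measure.conv (HeatEnergy.densityMeasure (g 0)) (HeatEnergy.heatMeasure n t)) := by
      intro t ht
      rw [HeatEnergy.energyDist_eq (hft t ht).1 (hgt t ht).1, (hft t ht).2, (hgt t ht).2]
    have hE0' := HeatEnergy.energyDist_eq hf0 hg0 α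
    rw [← hE0'] at hE0 hdecay
    rw [← hC] at hdecay
    refine ⟨fun hne => ?_, fun t ht => ?_, fun t ht => ?_, fun t ht => ?_, fun t ht => ?_⟩
    · rw [hC]
      refine HeatEnergy.decayConst_pos hn hα0 hα2 (ENNReal.toReal_nonneg.lt_of_ne fun h => hne ?_)
      rw [← h] at hdist
      exact HeatEnergy.ae_eq_of_densityMeasure_eq hf0 hg0
        (HeatEnergy.eq_of_norm_charFun_sub_le_zero hdist)
    · rcases ht.eq_or_lt with rfl | ht
      · exact HeatEnergy.energyConverges_of_moments hα0 hα2 hf0 hg0 hFm hGm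
      · exact (hconv t ht).1
    · obtain ⟨h1, h2, -, -⟩ := hdecay t ht
      have hI := HeatEnergy.negEnergyDist_eq (hft t ht).1 (hgt t ht).1 (hconv t ht).2
      rw [(hft t ht).2, (hgt t ht).2] at hI
      rw [hI, hE t ht]
      refine ⟨(hconv t ht).2, h1.congr_of_eventuallyEq ?_, h2⟩
      filter_upwards [Ioi_mem_nhds ht] with s hs
      exact hE s hs
    · rcases ht.eq_or_lt with rfl | ht
      · rw [mul_zero, add_zero, ← Real.rpow_mul hE0, neg_mul_neg,
          div_mul_div_cancel₀ (by linarith), div_self two_ne_zero, Real.rpow_one]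
      · rw [hE t ht]
        exact (hdecay t ht).2.2.1
    · rw [hE t ht]
      exact (hdecay t ht).2.2.2
  · have hGm : Integrable (fun x : EuclideanSpace ℝ (Fin n) => ‖x‖ ^ α) (Measure.dirac 0) :=
      integrable_dirac (by simp)
    have hgt : ∀ t, 0 < t → HeatEnergy.IsProbDensity (HeatEnergy.heatKernel n t) ∧
        HeatEnergy.densityMeasure (HeatEnergy.heatKernel n t) =
        Measure.conv (Measure.dirac 0) (HeatEnergy.heatMeasure n t) := fun t ht => by
      have := HeatEnergy.isProbabilityMeasure_heatMeasure (n := n) ht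
      exact ⟨HeatEnergy.isProbDensity_heatKernel ht, by
        rw [Measure.dirac_zero_conv, HeatEnergy.heatMeasure]⟩
    have hdist := HeatEnergy.norm_charFun_sub_le_fourierDistDirac hf0 hd
    have hconv := fun t (ht : 0 < t) => HeatEnergy.energyConverges_heat hn hα0 hα2 ht hFm hGm
      (hft t ht).1 (hgt t ht).1 (hft t ht).2 (hgt t ht).2
    obtain ⟨-, hdecay⟩ := HeatEnergy.measureEnergy_heat_decay hn hα0 hα2 hFm hGm
      ENNReal.toReal_nonneg hdist
    have hE : ∀ t, 0 < t → HeatEnergy.energyDist α (f t) (HeatEnergy.heatKernel n t) =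
        HeatEnergy.measureEnergy α
        (Measure.conv (HeatEnergy.densityMeasure (f 0)) (HeatEnergy.heatMeasure n t))
        (Measure.conv (Measure.dirac 0) (HeatEnergy.heatMeasure n t)) := by
      intro t ht
      rw [HeatEnergy.energyDist_eq (hft t ht).1 (hgt t ht).1, (hft t ht).2, (hgt t ht).2]
    rw [← HeatEnergy.energyDistDirac_eq hf0 hα0, ← hC] at hdecay
    refine ⟨?_, fun t ht => ?_⟩
    · rw [hC]
      refine HeatEnergy.decayConst_pos hn hα0 hα2 (ENNReal.toReal_nonneg.lt_of_ne fun h => ?_)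
      rw [← h] at hdist
      exact HeatEnergy.densityMeasure_ne_dirac hn _
        (HeatEnergy.eq_of_norm_charFun_sub_le_zero hdist)
    · obtain ⟨h1, h2, h3, h4⟩ := hdecay t ht
      have hI := HeatEnergy.negEnergyDist_eq (hft t ht).1 (hgt t ht).1 (hconv t ht).2
      rw [(hft t ht).2, (hgt t ht).2] at hI
      rw [hI, hE t ht]
      refine ⟨(hconv t ht).1, (hconv t ht).2, h1.congr_of_eventuallyEq ?_, h2, h3, h4⟩
      filter_upwards [Ioi_mem_nhds ht] with s hs
      exact hE s hs
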